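/- Let $\Gamma\subset\mathbb R^3$ be a closed oriented triangulated surface (a finite conforming mesh of non-degenerate flat triangles in which every edge lies in exactly two triangles and the triangles around each vertex form one cycle) with $N$ edges, $N_L$ vertices and $N_S$ cells (triangles). For each edge $m$ choose a name $v_m^+,v_m^-$ for its end points; let $c_m^+$ be the cell to the left of the edge directed from $v_m^-$ to $v_m^+$, $c_m^-$ the other cell containing it, and $r_m^\pm$ the vertex of $c_m^\pm$ opposite to the edge. Put $\langle a,b\rangle=\int_\Gamma a\cdot b\,dS$. Primal functions: the Rao-Wilton-Glisson functions $f_m(r)=\pm\frac{r-r_m^\pm}{2|c_m^\pm|}$ on $c_m^\pm$, zero elsewhere; the patches $p_c=|c|^{-1}$ on the cell $c$, zero elsewhere; the pyramids $\lambda_v$, continuous, affine on each cell, with $\lambda_v(w)=\delta_{vw}$ at the vertices $w$. Their Gram matrices are $G$, $G_p$, $G_\lambda$. Dual functions, on the barycentric refinement of the mesh: the dual patches $\tilde p_v$, equal to the inverse of the area of the dual cell of the vertex $v$ (the union of the refined triangles containing $v$) on that dual cell and zero elsewhere; the dual pyramids $\tilde\lambda_c$, continuous, affine on each refined triangle, equal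 to $1$ at the centroid of $c$, $\frac12$ at the midpoints of the edges of $c$, the inverse of the number of cells containing $v$ at each vertex $v$ of $c$, and $0$ at the other nodes; and dual vector elements $g_m$, one for each edge $m$, of Buffa-Christiansen or Chen-Wilton type, that is, $g_m$ is a combination of RWG functions of the refinement, vanishes outside the dual cells of $v_m^\pm$, and has total flux $\delta_{mm'}$ through the dual edge of each edge $m'$ (the two segments joining the midpoint of $m'$ to the centroids of its two cells), from the dual cell of $v_{m'}^+$ to that of $v_{m'}^-$, with zero flux through each of the two segments if $m'\ne m$. Their Gram matrices are $\mathbb G_{\tilde p}$, $\mathbb G_{\tilde\lambda}$, $\mathbb G$. Let $\Lambda\in\mathbb R^{N\times N_L}$ have entry $\pm1$ at $(m,v)$ if $v=v_m^\pm$ and $0$ otherwise, and let $\Sigma\in\mathbb R^{N\times N_S}$ have entry $\pm1$ at $(m,c)$ if $c=c_m^\pm$ and $0$ otherwise. Put $$\tilde\Lambda=G^{1/2}\Lambda G_\lambda^{-1/2},\quad \tilde\Sigma=G^{-1/2}\Sigma G_p^{1/2},\quad \tilde{\mathbb\Lambda}=\mathbb G^{-1/2}\Lambda\,\mathbb G_{\tilde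 p}^{1/2},\quad \tilde{\mathbb\Sigma}=\mathbb G^{1/2}\Sigma\,\mathbb G_{\tilde\lambda}^{-1/2},$$ and $P_X=X(X^TX)^+X^T$, where $^+$ is the Moore-Penrose pseudo-inverse; write $\tilde P^\Lambda=P_{\tilde\Lambda}$, $\tilde P^\Sigma=P_{\tilde\Sigma}$, $\tilde{\mathbb P}^\Lambda=P_{\tilde{\mathbb\Lambda}}$, $\tilde{\mathbb P}^\Sigma=P_{\tilde{\mathbb\Sigma}}$. Suppose that $\Gamma$ is simply connected (in particular connected). Then: 1. $\tilde P^\Lambda+\tilde P^\Sigma=I$ and $\tilde{\mathbb P}^\Lambda+\tilde{\mathbb P}^\Sigma=I$. 2. $\Sigma^T\Lambda=0$ and $\operatorname{rank}\Lambda+\operatorname{rank}\Sigma=N$; moreover $\tilde\Lambda$ and $\tilde{\mathbb\Lambda}$ have the rank of $\Lambda$, and $\tilde\Sigma$ and $\tilde{\mathbb\Sigma}$ have the rank of $\Sigma$. 3. Every $x\in\mathbb R^N$ can be written as $x=\tilde\Lambda l+\tilde\Sigma s$, and for every such representation $\tilde\Lambda l=\tilde P^\Lambda x$ and $\tilde\Sigma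 s=\tilde P^\Sigma x$, so the Loop part and the Star part of $x$ are unique. Likewise for $\tilde{\mathbb\Lambda},\tilde{\mathbb\Sigma}$ and the dual projectors. 4. If one vertex and one cell are chosen arbitrarily and their columns are removed from $\Lambda$ and $\Sigma$, and correspondingly their rows and columns from the Gram matrices $G_\lambda$, $G_p$, $\mathbb G_{\tilde p}$, $\mathbb G_{\tilde\lambda}$, then 1 still holds for the resulting matrices, and for every $x\in\mathbb R^N$ the coefficient vectors $l$ and $s$ of the decomposition of $x$ are themselves unique, in the primal and in the dual case. -/

import Mathlib

open MeasureTheory Matrix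
open scoped Classical MatrixOrder

noncomputable section

namespace LoopStar

/-- Euclidean three-space. -/
abbrev E3 : Type := EuclideanSpace ℝ (Fin 3)

/-! ### Triangulated closed oriented surfaces -/

/-- A triangular mesh of a closed oriented surface in space: a finite geometric simplicial complex
all of whose maximal faces are triangles, such that every edge lies in exactly two triangles, the
triangles around a vertex form a single cycle (any two of them are joined by a chain of triangles
around that vertex, consecutive ones sharing an edge), together with a coherent orientation.
`pos a b c` means that `a, b, c` are the three vertices of a triangle, listed in the positive sense
of rotation (counter-clockwise seen from the tip of the unit normal of the surface). -/
structure Surface where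
  /-- the underlying simplicial complex -/
  K : Geometry.SimplicialComplex ℝ E3
  finite_faces : K.faces.Finite
  exists_cell : ∀ s ∈ K.faces, ∃ t ∈ K.faces, s ⊆ t ∧ t.card = 3
  edge_two_cells : ∀ e ∈ K.faces, e.card = 2 →
    {t : Finset E3 | t ∈ K.faces ∧ t.card = 3 ∧ e ⊆ t}.ncard = 2
  star_connected : ∀ v : E3, ∀ s ∈ K.faces, ∀ t ∈ K.faces, s.card = 3 → t.card = 3 →
    v ∈ s → v ∈ t →
    Relation.ReflTransGen
      (fun a b : Finset E3 => b ∈ K.faces ∧ b.card = 3 ∧ v ∈ b ∧ (a ∩ b).card = 2) s t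
  /-- positively ordered triangles -/
  pos : E3 → E3 → E3 → Prop
  pos_mem : ∀ a b c, pos a b c → ({a, b, c} : Finset E3) ∈ K.faces
  pos_card : ∀ a b c, pos a b c → ({a, b, c} : Finset E3).card = 3
  pos_cyclic : ∀ a b c, pos a b c → pos b c a
  pos_or_pos : ∀ a b c, ({a, b, c} : Finset E3) ∈ K.faces → ({a, b, c} : Finset E3).card = 3 →
    pos a b c ∨ pos b a c
  pos_asymm : ∀ a b c, pos a b c → ¬ pos b a c
  /-- adjacent triangles induce opposite directions on their common edge -/
  pos_coherent : ∀ a b c d, pos a b c → pos a b d → c = d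

namespace Surface

variable (Γ : Surface)

/-- Vertices of the mesh. -/
abbrev Vertex : Type := {v : E3 // v ∈ Γ.K.vertices}

/-- Edges of the mesh. -/
abbrev Edge : Type := {e : Finset E3 // e ∈ Γ.K.faces ∧ e.card = 2}

/-- Cells (triangles) of the mesh. -/
abbrev Cell : Type := {t : Finset E3 // t ∈ Γ.K.faces ∧ t.card = 3}

instance : Fintype Γ.Edge :=
  (Γ.finite_faces.subset (fun _ h => h.1 : {e | e ∈ Γ.K.faces ∧ e.card = 2} ⊆ _)).fintype

instance : Fintype Γ.Cell :=
  (Γ.finite_faces.subset (fun _ h => h.1 : {t | t ∈ Γ.K.faces ∧ t.card = 3} ⊆ _)).fintype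

instance : Fintype Γ.Vertex :=
  @Fintype.ofFinite _ (Set.Finite.to_subtype
    (Γ.finite_faces.preimage (fun _ _ _ _ h => Finset.singleton_injective h)))

/-- The inclusion of all vertices but `v`. -/
def dropVertex (v : Γ.Vertex) : {n : Γ.Vertex // n ≠ v} → Γ.Vertex := Subtype.val

/-- The inclusion of all cells but `c`. -/
def dropCell (c : Γ.Cell) : {n : Γ.Cell // n ≠ c} → Γ.Cell := Subtype.val

/-- The surface as a set of points. -/
abbrev carrier : Set E3 := Γ.K.space

/-- The surface measure `dS` on `Γ`. -/
def surfaceMeasure : Measure E3 := (μHE[2] : Measure E3).restrict Γ.carrier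

/-- The Gram matrix `⟨f m, f n⟩ = ∫_Γ f m · f n dS` of a finite family of scalar or vector
functions on `Γ`. -/
def gram {ι F : Type*} [NormedAddCommGroup F] [InnerProductSpace ℝ F] (f : ι → E3 → F) :
    Matrix ι ι ℝ :=
  Matrix.of fun m n => ∫ r, inner ℝ (f m r) (f n r) ∂Γ.surfaceMeasure

end Surface

/-- Area of a subset of the surface. -/
def area (S : Set E3) : ℝ := ((μHE[2] : Measure E3) S).toReal

/-- The function that equals `f i` on the piece `S i`; on common boundaries of pieces the value of
one of the pieces is taken. -/
def glue {ι β : Type*} [Zero β] (S : ι → Set E3) (f : ι → E3 → β) (r : E3) : β :=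
  if h : ∃ i, r ∈ S i then f h.choose r else 0

/-- Barycentric coordinates of the point `r` with respect to the (affinely independent)
points `x`. -/
def bary {ι : Type*} [Fintype ι] (x : ι → E3) (r : E3) : ι → ℝ :=
  if h : ∃ w : ι → ℝ, ∑ k, w k = 1 ∧ ∑ k, w k • x k = r then h.choose else 0

/-! ### Rao-Wilton-Glisson functions, loop and star matrices -/

/-- Sign conventions for the Rao-Wilton-Glisson functions. The edge `m` has end points `vp m`,
`vm m`; the triangle to the left of the edge directed from `vm m` to `vp m` is `c⁺`, with third
vertex `rp m`, and the other one is `c⁻`, with third vertex `rm m`. -/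
structure Labels (Γ : Surface) where
  vp : Γ.Edge → E3
  vm : Γ.Edge → E3
  rp : Γ.Edge → E3
  rm : Γ.Edge → E3
  edge_eq : ∀ m : Γ.Edge, (m : Finset E3) = {vp m, vm m}
  pos_plus : ∀ m, Γ.pos (vm m) (vp m) (rp m)
  pos_minus : ∀ m, Γ.pos (vp m) (vm m) (rm m)

namespace Labels

variable {Γ : Surface} (R : Labels Γ)

/-- The cell `c⁺` of an edge. -/
def cellPlus (m : Γ.Edge) : Γ.Cell :=
  ⟨{R.vm m, R.vp m, R.rp m}, Γ.pos_mem _ _ _ (R.pos_plus m), Γ.pos_card _ _ _ (R.pos_plus m)⟩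

/-- The cell `c⁻` of an edge. -/
def cellMinus (m : Γ.Edge) : Γ.Cell :=
  ⟨{R.vp m, R.vm m, R.rm m}, Γ.pos_mem _ _ _ (R.pos_minus m), Γ.pos_card _ _ _ (R.pos_minus m)⟩

/-- The Rao-Wilton-Glisson functions. -/
def rwg (m : Γ.Edge) (r : E3) : E3 :=
  if r ∈ convexHull ℝ ((R.cellPlus m : Finset E3) : Set E3) then
    (1 / (2 * area (convexHull ℝ ((R.cellPlus m : Finset E3) : Set E3)))) • (r - R.rp m)
  else if r ∈ convexHull ℝ ((R.cellMinus m : Finset E3) : Set E3) then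
    -((1 / (2 * area (convexHull ℝ ((R.cellMinus m : Finset E3) : Set E3)))) • (r - R.rm m))
  else 0

/-- The Loop-to-RWG matrix `Λ`. -/
def loopMat : Matrix Γ.Edge Γ.Vertex ℝ :=
  Matrix.of fun m n => if (n : E3) = R.vp m then 1 else if (n : E3) = R.vm m then -1 else 0

/-- The Star-to-RWG matrix `Σ`. -/
def starMat : Matrix Γ.Edge Γ.Cell ℝ :=
  Matrix.of fun m n => if n = R.cellPlus m then 1 else if n = R.cellMinus m then -1 else 0

end Labels

namespace Surface

variable (Γ : Surface)

/-- Patch functions `p_n`, equal to `1 / A_n` on the cell `n`. -/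
def patch (n : Γ.Cell) (r : E3) : ℝ :=
  if r ∈ convexHull ℝ ((n : Finset E3) : Set E3) then
    (area (convexHull ℝ ((n : Finset E3) : Set E3)))⁻¹ else 0

/-- Pyramid functions `λ_n`: continuous, affine on every cell, equal to `1` at the vertex `n` and
to `0` at the other vertices. -/
def pyramid (n : Γ.Vertex) : E3 → ℝ :=
  glue (fun t : Γ.Cell => convexHull ℝ ((t : Finset E3) : Set E3)) fun t r =>
    if h : (n : E3) ∈ (t : Finset E3) then
      bary (fun x : {x // x ∈ (t : Finset E3)} => (x : E3)) r ⟨n, h⟩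
    else 0

/-! ### The barycentric refinement -/

/-- The triangles of the barycentric refinement correspond to the flags
`vertex ∈ edge ⊆ cell` of the mesh. -/
@[ext]
structure Flag where
  v : Γ.Vertex
  e : Γ.Edge
  t : Γ.Cell
  v_mem : (v : E3) ∈ (e : Finset E3)
  e_sub : (e : Finset E3) ⊆ (t : Finset E3)

instance : Fintype Γ.Flag :=
  Fintype.ofInjective (fun F : Γ.Flag => (F.v, F.e, F.t)) (by
    intro F F' h
    simp only [Prod.mk.injEq] at h
    exact Flag.ext h.1 h.2.1 h.2.2)

variable {Γ}

/-- Corners of a triangle of the refinement: the vertex, the midpoint of the edge and the centroid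
of the cell. -/
def Flag.corner (F : Γ.Flag) : Fin 3 → E3 :=
  ![(F.v : E3), (1 / 2 : ℝ) • ∑ x ∈ (F.e : Finset E3), x, (1 / 3 : ℝ) • ∑ x ∈ (F.t : Finset E3), x]

/-- The triangle of the refinement. -/
def Flag.region (F : Γ.Flag) : Set E3 := convexHull ℝ (Set.range F.corner)

/-- The lowest-order Raviart-Thomas (RWG) vector field on a triangle of the refinement whose
outward flux through the side opposite to the `k`-th corner is `φ k`. -/
def Flag.field (F : Γ.Flag) (φ : Fin 3 → ℝ) (r : E3) : E3 :=
  ∑ k, (φ k / (2 * area F.region)) • (r - F.corner k)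

variable (Γ)

/-- Number of cells around a vertex. -/
def valence (v : Γ.Vertex) : ℕ :=
  (Finset.univ.filter fun t : Γ.Cell => (v : E3) ∈ (t : Finset E3)).card

/-- The dual cell of a vertex: the union of the triangles of the refinement that contain it. -/
def dualCell (v : Γ.Vertex) : Set E3 := ⋃ (F : Γ.Flag) (_ : F.v = v), F.region

/-- Dual patch functions, equal to `1 / area` on the dual cell of a vertex. -/
def dualPatch (v : Γ.Vertex) (r : E3) : ℝ :=
  if r ∈ Γ.dualCell v then (area (Γ.dualCell v))⁻¹ else 0

/-- Dual pyramid functions, attached to a cell `c`: continuous, affine on every triangle of the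
refinement, equal to `1` at the centroid of `c`, to `1 / 2` at the midpoints of its edges, to
`1 / (number of cells around v)` at its vertices `v`, and to `0` at all other nodes. -/
def dualPyramid (c : Γ.Cell) : E3 → ℝ :=
  glue (fun F : Γ.Flag => F.region) fun F r => ∑ k, bary F.corner r k *
    (![if (F.v : E3) ∈ (c : Finset E3) then 1 / (Γ.valence F.v : ℝ) else 0,
       if (F.e : Finset E3) ⊆ (c : Finset E3) then 1 / 2 else 0,
       if F.t = c then 1 else 0] : Fin 3 → ℝ) k

end Surface

/-! ### Dual vector elements -/

/-- A family of dual div-conforming elements, one for every edge `m`, on the barycentric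
refinement. The `m`-th one is the combination of RWG functions of the refinement with the following
fluxes: `flux m F k` is the outward flux, out of the triangle `F` of the refinement, through the
side of `F` opposite to its `k`-th corner.
* Fluxes out of two triangles through their common side are opposite (`conf_*`).
* The element vanishes outside the dual cells of the two end points of `m` (`supp`).
* It has no flux through the dual edges (the common boundary of two dual cells, made of the two
  segments that join the midpoint of an edge to the centroids of its two cells) other than that of
  `m` (`flux_other`), and its total flux through the dual edge of `m`, from the dual cell of `v⁺`
  into that of `v⁻`, is `1` (`flux_self`).
The Buffa-Christiansen elements (`Labels.buffaChristiansen`) and the Chen-Wilton elements are of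
this kind; they differ in how the unit flux splits over the two segments of the dual edge and
in the fluxes inside the two dual cells. -/
structure DualElements {Γ : Surface} (R : Labels Γ) where
  flux : Γ.Edge → Γ.Flag → Fin 3 → ℝ
  conf_vertex : ∀ m (F F' : Γ.Flag), F ≠ F' → F.e = F'.e → F.t = F'.t →
    flux m F 0 + flux m F' 0 = 0
  conf_edge : ∀ m (F F' : Γ.Flag), F ≠ F' → F.v = F'.v → F.t = F'.t →
    flux m F 1 + flux m F' 1 = 0
  conf_cell : ∀ m (F F' : Γ.Flag), F ≠ F' → F.v = F'.v → F.e = F'.e →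
    flux m F 2 + flux m F' 2 = 0
  supp : ∀ (m : Γ.Edge) (F : Γ.Flag), (F.v : E3) ∉ (m : Finset E3) → flux m F = 0
  flux_other : ∀ m (F : Γ.Flag), F.e ≠ m → flux m F 0 = 0
  flux_self : ∀ m (F F' : Γ.Flag), F ≠ F' → F.v = F'.v → F.e = m → F'.e = m →
    flux m F 0 + flux m F' 0 = R.loopMat m F.v

/-- The `m`-th dual vector function of a family. -/
def DualElements.fn {Γ : Surface} {R : Labels Γ} (D : DualElements R) (m : Γ.Edge) : E3 → E3 :=
  glue (fun F : Γ.Flag => F.region) fun F r => F.field (D.flux m F) r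

namespace Surface

variable {Γ : Surface}

/-- Two triangles of the refinement are neighbours around a vertex of the mesh if they have this
vertex and a side through it in common. -/
def flagGraph (Γ : Surface) : SimpleGraph Γ.Flag where
  Adj F F' := F ≠ F' ∧ F.v = F'.v ∧ (F.e = F'.e ∨ F.t = F'.t)
  symm := ⟨fun _ _ h => ⟨h.1.symm, h.2.1.symm, h.2.2.imp Eq.symm Eq.symm⟩⟩

/-- For a triangle of the refinement at an end point of the edge `m`, the number of steps, around
that end point, to the closest of the two triangles of the refinement adjacent to `m`. -/
def flagDist (m : Γ.Edge) (F : Γ.Flag) : ℕ :=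
  sInf {d | ∃ F' : Γ.Flag, F'.v = F.v ∧ F'.e = m ∧ Γ.flagGraph.dist F' F = d}

lemma Flag.eq_of_vt {F A B : Γ.Flag} (hA : A ≠ F) (hB : B ≠ F) (hAv : A.v = F.v)
    (hBv : B.v = F.v) (hAt : A.t = F.t) (hBt : B.t = F.t) : A = B := by
  have hex : ∀ G : Γ.Flag, ∃ x, (G.e : Finset E3) = {(G.v : E3), x} ∧ x ≠ (G.v : E3) ∧
      x ∈ (G.t : Finset E3) := by
    intro G
    obtain ⟨a, b, hab, h⟩ := Finset.card_eq_two.1 G.e.2.2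
    have hv := G.v_mem
    have hs := G.e_sub
    rw [h] at hv hs
    simp only [Finset.mem_insert, Finset.mem_singleton] at hv
    rcases hv with hv | hv
    · exact ⟨b, by rw [h, hv], by rw [hv]; exact hab.symm, hs (by simp)⟩
    · exact ⟨a, by rw [h, hv, Finset.pair_comm], by rw [hv]; exact hab, hs (by simp)⟩
  obtain ⟨f, hf, hfv, hft⟩ := hex F
  obtain ⟨a, ha, hav, hat⟩ := hex A
  obtain ⟨b, hb, hbv, hbt⟩ := hex B
  rw [hAv] at ha hav
  rw [hBv] at hb hbv
  rw [hAt] at hat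
  rw [hBt] at hbt
  have haf : a ≠ f := fun h => hA (Flag.ext hAv (Subtype.ext (by rw [ha, hf, h])) hAt)
  have hbf : b ≠ f := fun h => hB (Flag.ext hBv (Subtype.ext (by rw [hb, hf, h])) hBt)
  have hab : a = b := by
    by_contra hab
    have hsub : ({(F.v : E3), f, a, b} : Finset E3) ⊆ F.t := by
      intro x hx
      simp only [Finset.mem_insert, Finset.mem_singleton] at hx
      rcases hx with rfl | rfl | rfl | rfl
      · exact F.e_sub F.v_mem
      all_goals assumption
    have hc := Finset.card_le_card hsub
    rw [F.t.2.2, Finset.card_insert_of_notMem, Finset.card_insert_of_notMem,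
      Finset.card_pair hab] at hc
    · omega
    · simp [haf.symm, hbf.symm]
    · simp [hfv.symm, hav.symm, hbv.symm]
  exact Flag.ext (hAv.trans hBv.symm) (Subtype.ext (by rw [ha, hb, hab])) (hAt.trans hBt.symm)

lemma Flag.eq_of_ve {F A B : Γ.Flag} (hA : A ≠ F) (hB : B ≠ F) (hAv : A.v = F.v)
    (hBv : B.v = F.v) (hAe : A.e = F.e) (hBe : B.e = F.e) : A = B := by
  obtain ⟨x, y, -, hxy⟩ := Set.ncard_eq_two.1 (Γ.edge_two_cells F.e F.e.2.1 F.e.2.2)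
  have hm : ∀ G : Γ.Flag, G.e = F.e → (G.t : Finset E3) = x ∨ (G.t : Finset E3) = y := by
    intro G hG
    have : (G.t : Finset E3) ∈ ({x, y} : Set (Finset E3)) := by
      rw [← hxy]
      exact ⟨G.t.2.1, G.t.2.2, hG ▸ G.e_sub⟩
    simpa using this
  have hAt : (A.t : Finset E3) ≠ F.t := fun h => hA (Flag.ext hAv hAe (Subtype.ext h))
  have hBt : (B.t : Finset E3) ≠ F.t := fun h => hB (Flag.ext hBv hBe (Subtype.ext h))
  refine Flag.ext (hAv.trans hBv.symm) (hAe.trans hBe.symm) (Subtype.ext ?_)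
  rcases hm A hAe with h1 | h1 <;> rcases hm B hBe with h2 | h2 <;> rcases hm F rfl with h3 | h3 <;>
    simp_all

end Surface

namespace Labels

variable {Γ : Surface} (R : Labels Γ)

/-- The flux of the Buffa-Christiansen element of the edge `m` from `F` to its neighbour `F'` around
an end point of `m` with `N` cells. The `2 N` triangles of the refinement around the end point are
counted `0, 1, …, N - 1` in both senses of rotation, starting at `m`; the side between the
triangles `k - 1` and `k` carries the flux `(N - k) / (2 N)`, directed towards `m` at `v⁺` and
away from `m` at `v⁻`. -/
def bcSpoke (m : Γ.Edge) (F F' : Γ.Flag) : ℝ :=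
  R.loopMat m F.v *
    (((Γ.valence F.v : ℝ) - (max (Γ.flagDist m F) (Γ.flagDist m F') : ℕ)) /
      (2 * (Γ.valence F.v : ℝ))) *
    ((SignType.sign ((Γ.flagDist m F : ℤ) - (Γ.flagDist m F' : ℤ)) : ℤ) : ℝ)

/-- Fluxes of the Buffa-Christiansen elements: half of the unit flux goes through each of the two
segments of the dual edge, and the charge is equally distributed over the triangles of the
refinement around each of the end points of the edge. -/
def bcFlux (m : Γ.Edge) (F : Γ.Flag) : Fin 3 → ℝ :=
  ![if F.e = m then R.loopMat m F.v / 2 else 0,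
    ∑ F' : Γ.Flag with F' ≠ F ∧ F'.v = F.v ∧ F'.t = F.t, R.bcSpoke m F F',
    ∑ F' : Γ.Flag with F' ≠ F ∧ F'.v = F.v ∧ F'.e = F.e, R.bcSpoke m F F']

lemma bcSpoke_antisymm (m : Γ.Edge) (F F' : Γ.Flag) (h : F.v = F'.v) :
    R.bcSpoke m F F' + R.bcSpoke m F' F = 0 := by
  unfold bcSpoke
  rw [h, max_comm (Γ.flagDist m F') (Γ.flagDist m F),
    show ((Γ.flagDist m F' : ℤ) - Γ.flagDist m F) = -((Γ.flagDist m F : ℤ) - Γ.flagDist m F') by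
      ring, Left.sign_neg]
  simp

lemma loopMat_of_notMem (m : Γ.Edge) (v : Γ.Vertex) (h : (v : E3) ∉ (m : Finset E3)) :
    R.loopMat m v = 0 := by
  rw [R.edge_eq m] at h
  simp only [Finset.mem_insert, Finset.mem_singleton, not_or] at h
  simp [loopMat, h.1, h.2]

/-- The Buffa-Christiansen elements. -/
def buffaChristiansen : DualElements R where
  flux := R.bcFlux
  conf_vertex m F F' hne he ht := by
    simp only [bcFlux, Matrix.cons_val_zero]
    rw [he]
    split_ifs with h
    · have hv : (F.v : E3) ≠ F'.v := fun h => hne (Surface.Flag.ext (Subtype.ext h) he ht)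
      have h1 := F.v_mem
      have h2 := F'.v_mem
      rw [he, h, R.edge_eq m] at h1
      rw [h, R.edge_eq m] at h2
      simp only [Finset.mem_insert, Finset.mem_singleton] at h1 h2
      have hpm : R.vp m ≠ R.vm m := by
        intro hh
        have := m.2.2
        rw [R.edge_eq m, hh] at this
        simp at this
      rcases h1 with h1 | h1 <;> rcases h2 with h2 | h2
      · exact absurd (h1.trans h2.symm) hv
      · simp [loopMat, h1, h2, hpm.symm]
        norm_num
      · simp [loopMat, h1, h2, hpm.symm]
        norm_num
      · exact absurd (h1.trans h2.symm) hv
    · simp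
  conf_edge m F F' hne hv ht := by
    have h1 : (Finset.univ.filter fun G : Γ.Flag => G ≠ F ∧ G.v = F.v ∧ G.t = F.t) = {F'} := by
      ext G
      simp only [Finset.mem_filter, Finset.mem_univ, true_and, Finset.mem_singleton]
      exact ⟨fun h => Surface.Flag.eq_of_vt h.1 hne.symm h.2.1 hv.symm h.2.2 ht.symm,
        fun h => h ▸ ⟨hne.symm, hv.symm, ht.symm⟩⟩
    have h2 : (Finset.univ.filter fun G : Γ.Flag => G ≠ F' ∧ G.v = F'.v ∧ G.t = F'.t) = {F} := by
      ext G
      simp only [Finset.mem_filter, Finset.mem_univ, true_and, Finset.mem_singleton]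
      exact ⟨fun h => Surface.Flag.eq_of_vt h.1 hne h.2.1 hv h.2.2 ht,
        fun h => h ▸ ⟨hne, hv, ht⟩⟩
    simp only [bcFlux, Matrix.cons_val_one, Matrix.cons_val_zero]
    rw [h1, h2, Finset.sum_singleton, Finset.sum_singleton]
    exact R.bcSpoke_antisymm m F F' hv
  conf_cell m F F' hne hv he := by
    have h1 : (Finset.univ.filter fun G : Γ.Flag => G ≠ F ∧ G.v = F.v ∧ G.e = F.e) = {F'} := by
      ext G
      simp only [Finset.mem_filter, Finset.mem_univ, true_and, Finset.mem_singleton]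
      exact ⟨fun h => Surface.Flag.eq_of_ve h.1 hne.symm h.2.1 hv.symm h.2.2 he.symm,
        fun h => h ▸ ⟨hne.symm, hv.symm, he.symm⟩⟩
    have h2 : (Finset.univ.filter fun G : Γ.Flag => G ≠ F' ∧ G.v = F'.v ∧ G.e = F'.e) = {F} := by
      ext G
      simp only [Finset.mem_filter, Finset.mem_univ, true_and, Finset.mem_singleton]
      exact ⟨fun h => Surface.Flag.eq_of_ve h.1 hne h.2.1 hv h.2.2 he,
        fun h => h ▸ ⟨hne, hv, he⟩⟩
    simp only [bcFlux, Matrix.cons_val_two, Matrix.tail_cons, Matrix.head_cons]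
    rw [h1, h2, Finset.sum_singleton, Finset.sum_singleton]
    exact R.bcSpoke_antisymm m F F' hv
  supp m F h := by
    have h0 := R.loopMat_of_notMem m F.v h
    ext k
    fin_cases k <;> simp [bcFlux, bcSpoke, h0]
  flux_other m F h := by simp [bcFlux, h]
  flux_self m F F' _ hv h h' := by simp [bcFlux, h, h', hv]

end Labels

/-! ### Pseudo-inverses, normalized matrices and projectors -/

section Matrices

variable {n m : Type*} [Fintype n] [Fintype m] [DecidableEq n] [DecidableEq m]

/-- The four Penrose conditions for `X` to be the Moore-Penrose pseudo-inverse of `A`. -/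
def IsMoorePenrose (A : Matrix n m ℝ) (X : Matrix m n ℝ) : Prop :=
  A * X * A = A ∧ X * A * X = X ∧ (A * X)ᵀ = A * X ∧ (X * A)ᵀ = X * A

/-- The Moore-Penrose pseudo-inverse. -/
def pinv (A : Matrix n m ℝ) : Matrix m n ℝ :=
  if h : ∃ X, IsMoorePenrose A X then h.choose else 0

/-- A symmetric matrix has a Moore-Penrose pseudo-inverse. -/
lemma exists_isMoorePenrose {A : Matrix n n ℝ} (hA : Aᵀ = A) : ∃ X, IsMoorePenrose A X := by
  have hA' : A.IsHermitian := by
    rw [Matrix.IsHermitian, Matrix.conjTranspose_eq_transpose_of_trivial, hA]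
  have hsa : IsSelfAdjoint A := hA'
  have hfin : (spectrum ℝ A).Finite := Matrix.finite_real_spectrum
  have hc : ∀ f : ℝ → ℝ, ContinuousOn f (spectrum ℝ A) := fun f => hfin.continuousOn f
  have hid : cfc (fun x : ℝ => x) A = A := cfc_id' ℝ A
  have h1 : A * cfc (fun x : ℝ => x⁻¹) A = cfc (fun x : ℝ => x * x⁻¹) A := by
    nth_rw 1 [← hid]
    rw [← cfc_mul _ _ A (hc _) (hc _)]
  have h2 : cfc (fun x : ℝ => x⁻¹) A * A = cfc (fun x : ℝ => x⁻¹ * x) A := by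
    nth_rw 2 [← hid]
    rw [← cfc_mul _ _ A (hc _) (hc _)]
  have ht : ∀ f : ℝ → ℝ, (cfc f A)ᵀ = cfc f A := fun f => by
    have := cfc_predicate f A
    rw [← Matrix.conjTranspose_eq_transpose_of_trivial]
    exact this
  refine ⟨cfc (fun x : ℝ => x⁻¹) A, ?_, ?_, ?_, ?_⟩
  · rw [h1]
    nth_rw 2 [← hid]
    rw [← cfc_mul _ _ A (hc _) (hc _)]
    simp only [mul_inv_mul_cancel]
    exact hid
  · rw [h2, ← cfc_mul _ _ A (hc _) (hc _)]
    congr 1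
    ext x
    by_cases hx : x = 0 <;> simp [hx]
  · rw [h1, ht]
  · rw [h2, ht]

/-- The pseudo-inverse of a symmetric matrix satisfies the Penrose conditions. -/
lemma isMoorePenrose_pinv {A : Matrix n n ℝ} (hA : Aᵀ = A) : IsMoorePenrose A (pinv A) := by
  have h := exists_isMoorePenrose hA
  rw [pinv, dif_pos h]
  exact h.choose_spec

/-- The square root `A^{1/2}` of a positive semidefinite matrix. -/
def rootMat (A : Matrix n n ℝ) : Matrix n n ℝ := CFC.sqrt A

/-- `G^{1/2} X H^{-1/2}`. -/
def normalizeUp (G : Matrix n n ℝ) (X : Matrix n m ℝ) (H : Matrix m m ℝ) : Matrix n m ℝ :=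
  rootMat G * X * (rootMat H)⁻¹

/-- `G^{-1/2} X H^{1/2}`. -/
def normalizeDown (G : Matrix n n ℝ) (X : Matrix n m ℝ) (H : Matrix m m ℝ) : Matrix n m ℝ :=
  (rootMat G)⁻¹ * X * rootMat H

/-- The projector `X (Xᵀ X)⁺ Xᵀ`. -/
def proj (X : Matrix n m ℝ) : Matrix n n ℝ := X * pinv (Xᵀ * X) * Xᵀ

end Matrices

namespace Labels

variable {Γ : Surface} (R : Labels Γ)

/-! In the following four definitions, `κ` selects columns, that is, vertices or cells:
the identity keeps all of them, an inclusion removes some. -/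

/-- Normalized Loop matrix `G^{1/2} Λ G_λ^{-1/2}`. -/
def primalLoop {ι : Type} [Fintype ι] [DecidableEq ι] (κ : ι → Γ.Vertex) : Matrix Γ.Edge ι ℝ :=
  normalizeUp (Γ.gram R.rwg) (R.loopMat.submatrix id κ) (Γ.gram fun i => Γ.pyramid (κ i))

/-- Normalized Star matrix `G^{-1/2} Σ G_p^{1/2}`. -/
def primalStar {ι : Type} [Fintype ι] [DecidableEq ι] (κ : ι → Γ.Cell) : Matrix Γ.Edge ι ℝ :=
  normalizeDown (Γ.gram R.rwg) (R.starMat.submatrix id κ) (Γ.gram fun i => Γ.patch (κ i))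

end Labels

namespace DualElements

variable {Γ : Surface} {R : Labels Γ} (D : DualElements R)

/-- Dually normalized Loop matrix `𝔾^{-1/2} Λ 𝔾_p̃^{1/2}`. -/
def dualLoop {ι : Type} [Fintype ι] [DecidableEq ι] (κ : ι → Γ.Vertex) : Matrix Γ.Edge ι ℝ :=
  normalizeDown (Γ.gram D.fn) (R.loopMat.submatrix id κ) (Γ.gram fun i => Γ.dualPatch (κ i))

/-- Dually normalized Star matrix `𝔾^{1/2} Σ 𝔾_λ̃^{-1/2}`. -/
def dualStar {ι : Type} [Fintype ι] [DecidableEq ι] (κ : ι → Γ.Cell) : Matrix Γ.Edge ι ℝ :=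
  normalizeUp (Γ.gram D.fn) (R.starMat.submatrix id κ) (Γ.gram fun i => Γ.dualPyramid (κ i))

end DualElements

end LoopStar

end

set_option linter.unusedSectionVars false

/-! The matrix `Λ` is the coboundary from vertex functions to edge vectors, a discrete gradient, and
`Σᵀ` is the coboundary from edge vectors to cells, a circulation. Thus `ΣᵀΛ = 0` says that a
gradient has no circulation. The topological content is the converse, `ker Σᵀ = range Λ`, that is,
the vanishing of the first cohomology; with rank-nullity it gives `rank Λ + rank Σ = N`.

The converse is first proved for integer edge vectors (`exists_potential_int`). An integer vector
without circulation is interpolated affinely on each cell; interpolations on different cells agree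
modulo 1 on common faces, so they form a continuous map from the surface to the circle `ℝ/ℤ`. Simple
connectedness yields a real potential of this map, and its increment along each edge is the given
integer. For a real vector, the entries generate a free abelian group of finite rank, and the
integer case applies to each coordinate (`exists_loopMat_mulVec_eq`).

All Gram matrices are positive definite. A combination that vanishes almost everywhere vanishes at
every point of each open triangle, where it is affine, and its nodal values or side fluxes then
determine the coefficients. The normalizing factors are therefore invertible and keep ranks; those
built from the Gram matrix of the vector functions cancel in the product of the Star transpose with
the Loop matrix, which keeps orthogonality. Two orthogonal ranges of complementary dimension have
orthogonal projectors with sum `1` (`proj_add_proj`).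

On a connected surface the kernels of `Λ` and of `Σ` consist of the constants. Removing one column
hence leaves the range unchanged and makes the remaining columns independent
(`rank_submatrix_dropColumn`), so the coefficients become unique. -/

namespace LoopStar

/-! ### Normalized matrices, projectors and complementary ranges -/

section MatrixLemmas

variable {n p q : Type*} [Fintype n] [Fintype p] [Fintype q]
  [DecidableEq n] [DecidableEq p] [DecidableEq q]

lemma rootMat_transpose (A : Matrix n n ℝ) : (rootMat A)ᵀ = rootMat A := by
  have h : IsSelfAdjoint (rootMat A) := (CFC.sqrt_nonneg A).isSelfAdjoint
  rw [← Matrix.conjTranspose_eq_transpose_of_trivial]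
  exact h

lemma isUnit_rootMat {A : Matrix n n ℝ} (hA : A.PosDef) : IsUnit (rootMat A) := by
  have h : rootMat A * rootMat A = A := CFC.sqrt_mul_sqrt_self A hA.posSemidef.nonneg
  have h' := hA.isUnit
  rw [← h] at h'
  exact isUnit_of_mul_isUnit_left h'

lemma rank_mul_mul_of_isUnit {S : Matrix n n ℝ} {U : Matrix p p ℝ} (hS : IsUnit S) (hU : IsUnit U)
    (A : Matrix n p ℝ) : (S * A * U).rank = A.rank := by
  rw [rank_mul_eq_left_of_isUnit_det _ _ ((isUnit_iff_isUnit_det _).1 hU),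
    rank_mul_eq_right_of_isUnit_det _ _ ((isUnit_iff_isUnit_det _).1 hS)]

lemma isUnit_nonsing_inv {S : Matrix n n ℝ} (hS : IsUnit S) : IsUnit S⁻¹ := by
  rw [Matrix.isUnit_nonsing_inv_iff]; exact hS

lemma rank_normalizeUp {G : Matrix n n ℝ} {H : Matrix p p ℝ} (hG : G.PosDef) (hH : H.PosDef)
    (A : Matrix n p ℝ) : (normalizeUp G A H).rank = A.rank :=
  rank_mul_mul_of_isUnit (isUnit_rootMat hG) (isUnit_nonsing_inv (isUnit_rootMat hH)) A

lemma rank_normalizeDown {G : Matrix n n ℝ} {H : Matrix p p ℝ} (hG : G.PosDef) (hH : H.PosDef)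
    (A : Matrix n p ℝ) : (normalizeDown G A H).rank = A.rank :=
  rank_mul_mul_of_isUnit (isUnit_nonsing_inv (isUnit_rootMat hG)) (isUnit_rootMat hH) A

/-- The factors `G^{-1/2}` and `G^{1/2}` meet in the middle of the product and cancel, which leaves
`Bᵀ * A`. -/
lemma normalizeDown_transpose_mul_normalizeUp {G : Matrix n n ℝ} (hG : G.PosDef)
    {H : Matrix p p ℝ} {K : Matrix q q ℝ} {A : Matrix n p ℝ} {B : Matrix n q ℝ}
    (hBA : Bᵀ * A = 0) : (normalizeDown G B K)ᵀ * normalizeUp G A H = 0 := by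
  have hu := (isUnit_iff_isUnit_det _).1 (isUnit_rootMat hG)
  rw [normalizeDown, normalizeUp, transpose_mul, transpose_mul, transpose_nonsing_inv,
    rootMat_transpose, rootMat_transpose]
  calc rootMat K * (Bᵀ * (rootMat G)⁻¹) * (rootMat G * A * (rootMat H)⁻¹)
      = rootMat K * (Bᵀ * (((rootMat G)⁻¹ * rootMat G) * A)) * (rootMat H)⁻¹ := by
        simp only [Matrix.mul_assoc]
    _ = 0 := by rw [nonsing_inv_mul _ hu, Matrix.one_mul, hBA]; simp

/-- No rank condition on `X` is needed: the first Penrose condition gives `XᵀX (pinv (XᵀX) XᵀX - 1)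
= 0`, and over the reals `XᵀX M = 0` forces `X M = 0`. -/
lemma proj_mul_self (X : Matrix n p ℝ) : proj X * X = X := by
  have hs : (Xᵀ * X)ᵀ = Xᵀ * X := by simp
  have h := (isMoorePenrose_pinv hs).1
  have h0 : Xᴴ * X * (pinv (Xᵀ * X) * (Xᵀ * X) - 1) = 0 := by
    rw [Matrix.mul_sub, conjTranspose_eq_transpose_of_trivial, ← Matrix.mul_assoc, h]
    simp
  rw [conjTranspose_mul_self_mul_eq_zero, Matrix.mul_sub, Matrix.mul_one, sub_eq_zero] at h0
  rw [proj, Matrix.mul_assoc, Matrix.mul_assoc]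
  exact h0

lemma proj_mul_of_orthogonal {X : Matrix n p ℝ} {Y : Matrix n q ℝ} (h : Xᵀ * Y = 0) :
    proj X * Y = 0 := by
  rw [proj, Matrix.mul_assoc, h, Matrix.mul_zero]

/-- Each of the two projectors fixes its own summand and annihilates the other. -/
lemma disjoint_range_of_orthogonal {X : Matrix n p ℝ} {Y : Matrix n q ℝ} (h : Yᵀ * X = 0)
    {l : p → ℝ} {s : q → ℝ} (hls : X *ᵥ l + Y *ᵥ s = 0) : X *ᵥ l = 0 ∧ Y *ᵥ s = 0 := by
  have h' : Xᵀ * Y = 0 := by rw [← transpose_transpose (Xᵀ * Y), transpose_mul]; simp [h]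
  have h1 := congrArg (proj X *ᵥ ·) hls
  have h2 := congrArg (proj Y *ᵥ ·) hls
  simp only [mulVec_add, mulVec_mulVec, proj_mul_self, proj_mul_of_orthogonal h,
    proj_mul_of_orthogonal h', zero_mulVec, add_zero, zero_add, mulVec_zero] at h1 h2
  exact ⟨h1, h2⟩

/-- Orthogonal ranges meet only in zero, so the dimension of their sum is the sum of the ranks,
which is that of the whole space. -/
lemma exists_decomposition {X : Matrix n p ℝ} {Y : Matrix n q ℝ} (h : Yᵀ * X = 0)
    (hr : X.rank + Y.rank = Fintype.card n) (x : n → ℝ) : ∃ l s, x = X *ᵥ l + Y *ᵥ s := by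
  have hinf : LinearMap.range X.mulVecLin ⊓ LinearMap.range Y.mulVecLin = ⊥ := by
    rw [eq_bot_iff]
    rintro _ ⟨⟨l, rfl⟩, ⟨s, hs⟩⟩
    have := (disjoint_range_of_orthogonal h (l := l) (s := -s) (by
      rw [mulVec_neg]; simp only [mulVecLin_apply] at hs; rw [hs]; simp)).1
    simpa using this
  have hd := Submodule.finrank_sup_add_finrank_inf_eq (LinearMap.range X.mulVecLin)
    (LinearMap.range Y.mulVecLin)
  rw [hinf, finrank_bot, add_zero] at hd
  have ht : LinearMap.range X.mulVecLin ⊔ LinearMap.range Y.mulVecLin = ⊤ := by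
    apply Submodule.eq_top_of_finrank_eq
    rw [hd, Module.finrank_fintype_fun_eq_card]
    exact hr
  obtain ⟨_, ⟨l, rfl⟩, _, ⟨s, rfl⟩, hx⟩ := Submodule.mem_sup.1 (ht ▸ Submodule.mem_top (x := x))
  exact ⟨l, s, hx.symm⟩

lemma proj_mulVec_of_eq {X : Matrix n p ℝ} {Y : Matrix n q ℝ} (h : Yᵀ * X = 0) {x : n → ℝ}
    {l : p → ℝ} {s : q → ℝ} (hx : x = X *ᵥ l + Y *ᵥ s) :
    X *ᵥ l = proj X *ᵥ x ∧ Y *ᵥ s = proj Y *ᵥ x := by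
  have h' : Xᵀ * Y = 0 := by rw [← transpose_transpose (Xᵀ * Y), transpose_mul]; simp [h]
  rw [hx]
  simp only [mulVec_add, mulVec_mulVec, proj_mul_self, proj_mul_of_orthogonal h,
    proj_mul_of_orthogonal h', zero_mulVec, add_zero, zero_add, and_self]

lemma proj_add_proj {X : Matrix n p ℝ} {Y : Matrix n q ℝ} (h : Yᵀ * X = 0)
    (hr : X.rank + Y.rank = Fintype.card n) : proj X + proj Y = 1 := by
  apply Matrix.ext_of_mulVec_single
  intro i
  obtain ⟨l, s, hx⟩ := exists_decomposition h hr (Pi.single i 1)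
  obtain ⟨h1, h2⟩ := proj_mulVec_of_eq h hx
  rw [add_mulVec, ← h1, ← h2, ← hx, one_mulVec]

lemma mulVec_injective_of_rank {X : Matrix n p ℝ} (h : X.rank = Fintype.card p) :
    Function.Injective X.mulVec := by
  have := LinearMap.finrank_range_add_finrank_ker X.mulVecLin
  rw [Module.finrank_fintype_fun_eq_card] at this
  have hk : Module.finrank ℝ (LinearMap.ker X.mulVecLin) = 0 := by
    change X.rank + _ = _ at this
    omega
  exact LinearMap.ker_eq_bot.1 (Submodule.finrank_eq_zero.1 hk)

lemma existsUnique_decomposition {X : Matrix n p ℝ} {Y : Matrix n q ℝ} (h : Yᵀ * X = 0)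
    (hr : X.rank + Y.rank = Fintype.card n) (hX : X.rank = Fintype.card p)
    (hY : Y.rank = Fintype.card q) (x : n → ℝ) :
    ∃! c : (p → ℝ) × (q → ℝ), x = X *ᵥ c.1 + Y *ᵥ c.2 := by
  obtain ⟨l, s, hx⟩ := exists_decomposition h hr x
  refine ⟨(l, s), hx, ?_⟩
  rintro ⟨l', s'⟩ hx'
  obtain ⟨h1, h2⟩ := proj_mulVec_of_eq h hx
  obtain ⟨h3, h4⟩ := proj_mulVec_of_eq h hx'
  exact Prod.ext (mulVec_injective_of_rank hX (h3.trans h1.symm))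
    (mulVec_injective_of_rank hY (h4.trans h2.symm))

/-- Removing one column from a matrix whose kernel consists of the constant vectors leaves a
matrix of the same rank with independent columns. -/
lemma rank_submatrix_dropColumn (A : Matrix n p ℝ) (v : p) (h1 : A *ᵥ 1 = 0)
    (hk : ∀ x, A *ᵥ x = 0 → ∀ i j, x i = x j) :
    (A.submatrix id (Subtype.val : {i // i ≠ v} → p)).rank = A.rank ∧
    (A.submatrix id (Subtype.val : {i // i ≠ v} → p)).rank = Fintype.card {i // i ≠ v} := by
  set B := A.submatrix id (Subtype.val : {i // i ≠ v} → p) with hB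
  -- Vectors on the remaining columns are treated as full vectors with entry zero at `v`.
  have hBA : ∀ x : p → ℝ, x v = 0 → B *ᵥ (fun i => x i) = A *ᵥ x := by
    intro x hx
    ext m
    simp only [mulVec, dotProduct, hB, submatrix_apply, id]
    rw [← Fintype.sum_subtype_add_sum_subtype (fun i => i ≠ v) (fun i => A m i * x i)]
    have : ∑ i : {i // ¬ i ≠ v}, A m i * x i = 0 :=
      Finset.sum_eq_zero fun i _ => by rw [not_not.1 i.2, hx, mul_zero]
    rw [this, add_zero]
  have hext : ∀ y : {i // i ≠ v} → ℝ, ∃ x : p → ℝ, x v = 0 ∧ (fun i : {i // i ≠ v} => x i) = y :=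
    fun y => ⟨fun i => if h : i ≠ v then y ⟨i, h⟩ else 0, by simp,
      funext fun i => by simp [i.2]⟩
  have hr : LinearMap.range B.mulVecLin = LinearMap.range A.mulVecLin := by
    apply le_antisymm
    · rintro _ ⟨y, rfl⟩
      obtain ⟨x, hx, rfl⟩ := hext y
      exact ⟨x, by simp [hBA x hx]⟩
    · rintro _ ⟨x, rfl⟩
      -- Subtracting the constant `x v`, which lies in the kernel of `A`, makes the entry at `v`
      -- vanish without changing the image.
      refine ⟨fun i => x i - x v, ?_⟩
      have := hBA (x - x v • (1 : p → ℝ)) (by simp)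
      simp only [mulVec_sub, mulVec_smul, h1, smul_zero, sub_zero] at this
      simpa using this
  refine ⟨by rw [Matrix.rank, hr]; rfl, ?_⟩
  have hinj : LinearMap.ker B.mulVecLin = ⊥ := by
    rw [LinearMap.ker_eq_bot']
    intro y hy
    obtain ⟨x, hx, rfl⟩ := hext y
    -- The extension by zero lies in the kernel of `A`, so it is constant, and its value at `v` is
    -- zero.
    have := hk x (by rw [← hBA x hx]; exact hy)
    ext i
    rw [this i v, hx]; rfl
  have := LinearMap.finrank_range_add_finrank_ker B.mulVecLin
  rw [hinj, finrank_bot, add_zero, Module.finrank_fintype_fun_eq_card] at this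
  exact this

end MatrixLemmas

/-! ### Lifting maps to the circle on simply connected spaces -/

open unitInterval in
/-- A continuous map from a simply connected space to the circle has a real potential along
paths. -/
lemma exists_potential_of_continuous_addCircle {X : Type*} [TopologicalSpace X]
    [SimplyConnectedSpace X] {u : X → AddCircle (1 : ℝ)} (hu : Continuous u) :
    ∃ l : X → ℝ, ∀ (a b : X) (τ : Path a b) (s : C(I, ℝ)),
      (∀ t, (s t : AddCircle (1 : ℝ)) = u (τ t)) → l b - l a = s 1 - s 0 := by
  have cov := AddCircle.isCoveringMap_coe (1 : ℝ)
  obtain ⟨x₀⟩ : Nonempty X := inferInstance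
  obtain ⟨e₀, he₀⟩ := QuotientAddGroup.mk_surjective (u x₀)
  have he₀' : (e₀ : AddCircle (1 : ℝ)) = u x₀ := he₀
  let γ : ∀ x, Path x₀ x := fun x => PathConnectedSpace.somePath x₀ x
  have h0 : ∀ x, ((γ x).map hu) 0 = ((e₀ : ℝ) : AddCircle (1 : ℝ)) := fun x => by simp [he₀']
  -- The potential at `x` is the end value of the lift along a chosen path from `x₀`; its continuity
  -- is not needed.
  refine ⟨fun x => cov.liftPath ((γ x).map hu) e₀ (h0 x) 1, fun a b τ s hs => ?_⟩
  set g := cov.liftPath ((γ a).map hu) e₀ (h0 a) with hg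
  have h1 : (((γ a).map hu).trans (τ.map hu)) 0 = ((e₀ : ℝ) : AddCircle (1 : ℝ)) := by
    simp [he₀']
  -- Simple connectedness enters here: the chosen path to `b` is homotopic to the one that passes
  -- through `a` and follows `τ`, so both lifts end at the same real number.
  have hhom : Path.Homotopic ((γ b).map hu) (((γ a).map hu).trans (τ.map hu)) := by
    have := (SimplyConnectedSpace.paths_homotopic (γ b) ((γ a).trans τ)).map ⟨u, hu⟩
    rw [← Path.map_trans]
    exact this
  have key := cov.liftPath_apply_one_eq_of_homotopicRel hhom e₀ (h0 b) h1
  have htr := cov.liftPath_trans he₀'.symm ((γ a).map hu) (τ.map hu)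
  have hlift : ((g 1 : ℝ) : AddCircle (1 : ℝ)) = u a := by
    have := congrFun (cov.liftPath_lifts ((γ a).map hu) e₀ (h0 a)) 1
    simpa using this
  have hlift2 : (τ.map hu) 0 = ((g 1 : ℝ) : AddCircle (1 : ℝ)) := by simp [hlift]
  -- Both `s 0` and `g 1` lie over `u a`, so the translate of `s` that starts at `g 1` is the lift
  -- of `τ` from there.
  have hs2 : (⟨fun t => g 1 + (s t - s 0), by fun_prop⟩ : C(I, ℝ)) =
      cov.liftPath (τ.map hu) (g 1) hlift2 := by
    rw [cov.eq_liftPath_iff']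
    refine ⟨?_, by simp⟩
    ext t
    have e1 := hs t
    have e2 := hs 0
    simp only [Path.source] at e2
    simp only [Function.comp_apply, ContinuousMap.coe_mk, AddCircle.coe_add, AddCircle.coe_sub,
      hlift, e1, e2, Path.map_coe]
    simp
  have h3 : cov.liftPath (((γ a).map hu).trans (τ.map hu)) e₀ h1 1 =
      cov.liftPath (τ.map hu) (g 1) hlift2 1 := by
    have := congrArg (fun f : C(I, ℝ) => f 1) htr
    simpa using this
  rw [← hs2] at h3
  simp only [ContinuousMap.coe_mk] at h3
  change cov.liftPath ((γ b).map hu) e₀ (h0 b) 1 - g 1 = s 1 - s 0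
  rw [sub_eq_iff_eq_add]
  refine (key.trans h3).trans ?_
  ring

/-! ### Barycentric coordinates -/

section Bary

variable {ι : Type*} [Fintype ι] {x : ι → E3}

lemma eq_of_sum_smul_eq (hx : AffineIndependent ℝ x) {w w' : ι → ℝ} (hw : ∑ k, w k = 1)
    (hw' : ∑ k, w' k = 1) (h : ∑ k, w k • x k = ∑ k, w' k • x k) : w = w' := by
  have := (affineIndependent_iff_of_fintype ℝ x).1 hx (w - w') (by simp [hw, hw'])
  rw [Finset.weightedVSub_eq_linear_combination _ (by simp [hw, hw'])] at this
  have := this (by simp [sub_smul, h])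
  ext i
  exact sub_eq_zero.1 (this i)

lemma bary_sum_smul (hx : AffineIndependent ℝ x) {w : ι → ℝ} (hw : ∑ k, w k = 1) :
    bary x (∑ k, w k • x k) = w := by
  have h : ∃ w' : ι → ℝ, ∑ k, w' k = 1 ∧ ∑ k, w' k • x k = ∑ k, w k • x k := ⟨w, hw, rfl⟩
  rw [bary, dif_pos h]
  exact eq_of_sum_smul_eq hx h.choose_spec.1 hw h.choose_spec.2

/-- Barycentric coordinates extend to continuous functions on the whole space. -/
lemma exists_continuous_coords (hx : AffineIndependent ℝ x) :
    ∃ A : E3 → ι → ℝ, Continuous A ∧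
      ∀ w : ι → ℝ, ∑ k, w k = 1 → A (∑ k, w k • x k) = w := by
  -- Recording the total weight next to the combination makes this linear map injective exactly by
  -- affine independence; a left inverse evaluated at `(r, 1)` yields the coordinates.
  let L : (ι → ℝ) →ₗ[ℝ] E3 × ℝ :=
    (∑ k, (LinearMap.proj k).smulRight (x k)).prod (∑ k, LinearMap.proj k)
  have hL : ∀ w, L w = (∑ k, w k • x k, ∑ k, w k) := fun w => by simp [L]
  have hinj : LinearMap.ker L = ⊥ := by
    rw [LinearMap.ker_eq_bot']
    intro w hw
    rw [hL, Prod.mk_eq_zero] at hw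
    have := (affineIndependent_iff_of_fintype ℝ x).1 hx w hw.2
    rw [Finset.weightedVSub_eq_linear_combination _ hw.2] at this
    exact funext (this hw.1)
  obtain ⟨M, hM⟩ := L.exists_leftInverse_of_injective hinj
  refine ⟨fun r => M (r, 1), ?_, fun w hw => ?_⟩
  · exact M.continuous_of_finiteDimensional.comp (by fun_prop)
  · have := LinearMap.congr_fun hM w
    rw [LinearMap.comp_apply, hL, hw] at this
    exact this

lemma mem_convexHull_range_iff {r : E3} :
    r ∈ convexHull ℝ (Set.range x) ↔
      ∃ w : ι → ℝ, (∀ k, 0 ≤ w k) ∧ ∑ k, w k = 1 ∧ ∑ k, w k • x k = r := by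
  constructor
  · intro h
    rw [convexHull_range_eq_exists_affineCombination] at h
    obtain ⟨s, w, h0, h1, rfl⟩ := h
    refine ⟨fun k => if k ∈ s then w k else 0, fun k => ?_, ?_, ?_⟩
    · dsimp only
      split_ifs with hk
      · exact h0 k hk
      · exact le_rfl
    · simpa using h1
    · rw [s.affineCombination_eq_linear_combination _ _ h1]
      simp [ite_smul]
  · rintro ⟨w, h0, h1, rfl⟩
    exact (convex_convexHull ℝ _).sum_mem (fun k _ => h0 k) h1
      fun k _ => subset_convexHull ℝ _ ⟨k, rfl⟩

end Bary

/-- Continuous barycentric coordinates for a finite affinely independent set. -/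
lemma exists_continuous_coords_finset {t : Finset E3}
    (ht : AffineIndependent ℝ ((↑) : t → E3)) :
    ∃ A : E3 → E3 → ℝ, (∀ y, Continuous fun r => A r y) ∧
      ∀ w : E3 → ℝ, ∑ y ∈ t, w y = 1 → ∀ y ∈ t, A (∑ y ∈ t, w y • y) y = w y := by
  obtain ⟨A, hA, h⟩ := exists_continuous_coords ht
  refine ⟨fun r y => if hy : y ∈ t then A r ⟨y, hy⟩ else 0, fun y => ?_, fun w hw y hy => ?_⟩
  · by_cases hy : y ∈ t
    · simp only [hy, dif_pos]
      exact (continuous_apply _).comp hA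
    · simp only [hy, dif_neg, not_false_eq_true]
      exact continuous_const
  · have := h (fun y => w y) (by rw [← hw]; exact Finset.sum_coe_sort t w)
    rw [Finset.sum_coe_sort t fun y => w y • y] at this
    simp only [hy, dif_pos]
    rw [this]

/-! ### Cells, edges and cochains -/

namespace Surface

variable {Γ : Surface}

lemma pos_ne {a b d : E3} (h : Γ.pos a b d) : a ≠ b ∧ a ≠ d ∧ b ≠ d := by
  have hc := Γ.pos_card a b d h
  refine ⟨?_, ?_, ?_⟩
  · rintro rfl
    rw [Finset.insert_eq_of_mem (by simp)] at hc
    have := Finset.card_le_two (a := a) (b := d)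
    omega
  · rintro rfl
    rw [Finset.insert_eq_of_mem (by simp)] at hc
    have := Finset.card_le_two (a := b) (b := a)
    omega
  · rintro rfl
    rw [Finset.pair_eq_singleton] at hc
    have := Finset.card_le_two (a := a) (b := b)
    omega

/-- The cell of a positively ordered triangle. -/
noncomputable def posCell {a b d : E3} (h : Γ.pos a b d) : Γ.Cell :=
  ⟨{a, b, d}, Γ.pos_mem _ _ _ h, Γ.pos_card _ _ _ h⟩

/-- The first edge of a positively ordered triangle. -/
noncomputable def posEdge {a b d : E3} (h : Γ.pos a b d) : Γ.Edge :=
  ⟨{a, b}, Γ.K.down_closed (Γ.pos_mem _ _ _ h) (by intro x; simp; tauto) (by simp),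
    Finset.card_pair (pos_ne h).1⟩

lemma exists_pos_of_distinct (t : Γ.Cell) {a b d : E3} (ha : a ∈ (t : Finset E3))
    (hb : b ∈ (t : Finset E3)) (hd : d ∈ (t : Finset E3)) (hab : a ≠ b) (had : a ≠ d)
    (hbd : b ≠ d) : (t : Finset E3) = {a, b, d} ∧ (Γ.pos a b d ∨ Γ.pos b a d) := by
  have hc : ({a, b, d} : Finset E3).card = 3 := Finset.card_eq_three.2 ⟨a, b, d, hab, had, hbd, rfl⟩
  have ht : (t : Finset E3) = {a, b, d} := by
    symm
    apply Finset.eq_of_subset_of_card_le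
    · intro x hx
      simp only [Finset.mem_insert, Finset.mem_singleton] at hx
      rcases hx with rfl | rfl | rfl <;> assumption
    · rw [hc, t.2.2]
  exact ⟨ht, Γ.pos_or_pos a b d (ht ▸ t.2.1) hc⟩

lemma exists_pos (t : Γ.Cell) : ∃ a b d, Γ.pos a b d ∧ (t : Finset E3) = {a, b, d} := by
  obtain ⟨a, b, d, hab, had, hbd, ht⟩ := Finset.card_eq_three.1 t.2.2
  obtain ⟨-, h | h⟩ := exists_pos_of_distinct t (a := a) (b := b) (d := d) (by simp [ht])
    (by simp [ht]) (by simp [ht]) hab had hbd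
  · exact ⟨a, b, d, h, ht⟩
  · exact ⟨b, a, d, h, by rw [ht, Finset.insert_comm]⟩

lemma mem_vertices_of_mem_cell (t : Γ.Cell) {a : E3} (ha : a ∈ (t : Finset E3)) :
    a ∈ Γ.K.vertices :=
  Γ.K.down_closed t.2.1 (Finset.singleton_subset_iff.2 ha) (Finset.singleton_nonempty _)

lemma exists_cell_of_vertex (v : Γ.Vertex) : ∃ t : Γ.Cell, (v : E3) ∈ (t : Finset E3) := by
  obtain ⟨t, ht, hs, hc⟩ := Γ.exists_cell _ v.2
  exact ⟨⟨t, ht, hc⟩, hs (by simp)⟩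

lemma mem_carrier_iff {r : E3} :
    r ∈ Γ.carrier ↔ ∃ t : Γ.Cell, r ∈ convexHull ℝ ((t : Finset E3) : Set E3) := by
  rw [carrier, Geometry.SimplicialComplex.mem_space_iff]
  constructor
  · rintro ⟨s, hs, hr⟩
    obtain ⟨t, ht, hst, hc⟩ := Γ.exists_cell s hs
    exact ⟨⟨t, ht, hc⟩, convexHull_mono (Finset.coe_subset.2 hst) hr⟩
  · rintro ⟨t, hr⟩
    exact ⟨t, t.2.1, hr⟩

lemma convexHull_cell_subset (t : Γ.Cell) :
    convexHull ℝ ((t : Finset E3) : Set E3) ⊆ Γ.carrier :=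
  fun _ hr => mem_carrier_iff.2 ⟨t, hr⟩

lemma isClosed_convexHull_cell (t : Γ.Cell) :
    IsClosed (convexHull ℝ ((t : Finset E3) : Set E3)) :=
  (t : Finset E3).finite_toSet.isClosed_convexHull ℝ

end Surface

namespace Labels

variable {Γ : Surface} (R : Labels Γ)

lemma vp_ne_vm (m : Γ.Edge) : R.vp m ≠ R.vm m :=
  (Surface.pos_ne (R.pos_minus m)).1

/-- If the cells coincided, so would their third vertices, and one triangle would be positive in
both senses, against `pos_asymm`. -/
lemma cellPlus_ne_cellMinus (m : Γ.Edge) : R.cellPlus m ≠ R.cellMinus m := by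
  intro h
  have h' : ({R.vm m, R.vp m, R.rp m} : Finset E3) = {R.vp m, R.vm m, R.rm m} :=
    congrArg Subtype.val h
  have hr : R.rp m ∈ ({R.vp m, R.vm m, R.rm m} : Finset E3) := h' ▸ by simp
  have h1 := Surface.pos_ne (R.pos_plus m)
  simp only [Finset.mem_insert, Finset.mem_singleton] at hr
  rcases hr with hr | hr | hr
  · exact h1.2.2 hr.symm
  · exact h1.2.1 hr.symm
  · exact Γ.pos_asymm _ _ _ (R.pos_plus m) (hr ▸ R.pos_minus m)

section Cochain

variable {A B : Type*} [AddCommGroup A] [AddCommGroup B]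

/-- The edge vector `x` as an antisymmetric function of the end points of an oriented edge. -/
noncomputable def cochain (x : Γ.Edge → A) (a b : E3) : A :=
  ∑ m, if R.vm m = a ∧ R.vp m = b then x m else if R.vp m = a ∧ R.vm m = b then -x m else 0

lemma cochain_antisymm (x : Γ.Edge → A) (a b : E3) : R.cochain x a b = -R.cochain x b a := by
  rw [cochain, cochain, ← Finset.sum_neg_distrib]
  refine Finset.sum_congr rfl fun m _ => ?_
  simp only [and_comm (a := R.vm m = b), and_comm (a := R.vp m = b)]
  by_cases h1 : R.vm m = a ∧ R.vp m = b
  · have h2 : ¬ (R.vp m = a ∧ R.vm m = b) := fun h => R.vp_ne_vm m (h.1.trans h1.1.symm)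
    rw [if_pos h1, if_neg h2, if_pos h1, neg_neg]
  · by_cases h2 : R.vp m = a ∧ R.vm m = b
    · rw [if_neg h1, if_pos h2, if_pos h2]
    · rw [if_neg h1, if_neg h2, if_neg h2, if_neg h1, neg_zero]

lemma cochain_self (x : Γ.Edge → A) (a : E3) : R.cochain x a a = 0 := by
  refine Finset.sum_eq_zero fun m _ => ?_
  have h := R.vp_ne_vm m
  rw [if_neg (fun h1 => h (h1.2.trans h1.1.symm)), if_neg (fun h1 => h (h1.1.trans h1.2.symm))]

lemma cochain_vm_vp (x : Γ.Edge → A) (m : Γ.Edge) : R.cochain x (R.vm m) (R.vp m) = x m := by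
  rw [cochain, Finset.sum_eq_single m]
  · simp
  · intro m' _ hm
    rw [if_neg, if_neg]
    · rintro ⟨h1, h2⟩
      exact hm (Subtype.ext (by rw [R.edge_eq, R.edge_eq m, h1, h2, Finset.pair_comm]))
    · rintro ⟨h1, h2⟩
      exact hm (Subtype.ext (by rw [R.edge_eq, R.edge_eq m, h1, h2]))
  · simp

/-- Naturality in the coefficient group serves to split a real edge vector into integer coordinate
vectors. -/
lemma cochain_comp (φ : A →+ B) (x : Γ.Edge → A) (a b : E3) :
    R.cochain (fun m => φ (x m)) a b = φ (R.cochain x a b) := by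
  simp only [cochain, map_sum, apply_ite φ, map_neg, map_zero]

/-- Vanishing circulation around every cell. -/
def IsClosedCochain (x : Γ.Edge → A) : Prop :=
  ∀ a b d, Γ.pos a b d → R.cochain x a b + R.cochain x b d + R.cochain x d a = 0

variable {R}

/-- Degenerate triples follow from antisymmetry, negatively ordered ones from reversing the
circulation. The identity shows that a change of base vertex within a cell shifts the local
potential by a constant. -/
lemma IsClosedCochain.add_eq {x : Γ.Edge → A} (hx : R.IsClosedCochain x) (t : Γ.Cell)
    {a b d : E3} (ha : a ∈ (t : Finset E3)) (hb : b ∈ (t : Finset E3))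
    (hd : d ∈ (t : Finset E3)) : R.cochain x a b + R.cochain x b d = R.cochain x a d := by
  by_cases hab : a = b
  · rw [hab, cochain_self, zero_add]
  by_cases hbd : b = d
  · rw [hbd, cochain_self, add_zero]
  by_cases had : a = d
  · rw [had, R.cochain_antisymm x d b, cochain_self, neg_add_cancel]
  rw [← sub_eq_zero, sub_eq_add_neg, ← R.cochain_antisymm x d a]
  rcases (Surface.exists_pos_of_distinct t ha hb hd hab had hbd).2 with h | h
  · exact hx a b d h
  · have := hx b a d h
    rw [R.cochain_antisymm x b a, R.cochain_antisymm x a d, R.cochain_antisymm x d b] at this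
    rw [← neg_eq_zero, ← this]
    abel

end Cochain

/-- `starMatᵀ` computes circulations around cells. -/
lemma starMat_transpose_mulVec (x : Γ.Edge → ℝ) {a b d : E3} (h : Γ.pos a b d) :
    (R.starMatᵀ *ᵥ x) (Surface.posCell h) =
      R.cochain x a b + R.cochain x b d + R.cochain x d a := by
  have h2 := Γ.pos_cyclic _ _ _ h
  have h3 := Γ.pos_cyclic _ _ _ h2
  obtain ⟨hab, had, hbd⟩ := Surface.pos_ne h
  -- The sign in `Σ` compensates the direction in which the edge is labelled; `pos_coherent` decides
  -- which of the two cells of the edge is meant. The cyclic rotations of the triple give the other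
  -- two sides.
  have key : ∀ {a b d : E3} (h : Γ.pos a b d),
      R.starMat (Surface.posEdge h) (Surface.posCell h) * x (Surface.posEdge h) =
        R.cochain x a b := by
    intro a b d h
    set m := Surface.posEdge h with hm
    have he : ({a, b} : Finset E3) = {R.vp m, R.vm m} := R.edge_eq m
    have hab := (Surface.pos_ne h).1
    have hcases : (R.vm m = a ∧ R.vp m = b) ∨ (R.vp m = a ∧ R.vm m = b) := by
      have ha : a ∈ ({R.vp m, R.vm m} : Finset E3) := he ▸ by simp
      have hb : b ∈ ({R.vp m, R.vm m} : Finset E3) := he ▸ by simp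
      simp only [Finset.mem_insert, Finset.mem_singleton] at ha hb
      rcases ha with ha | ha <;> rcases hb with hb | hb
      · exact absurd (ha.trans hb.symm) hab
      · exact Or.inr ⟨ha.symm, hb.symm⟩
      · exact Or.inl ⟨ha.symm, hb.symm⟩
      · exact absurd (ha.trans hb.symm) hab
    rcases hcases with ⟨h1, h2⟩ | ⟨h1, h2⟩
    · have hp : Surface.posCell h = R.cellPlus m := by
        have hr : d = R.rp m := Γ.pos_coherent a b _ _ h (h1 ▸ h2 ▸ R.pos_plus m)
        apply Subtype.ext
        change ({a, b, d} : Finset E3) = {R.vm m, R.vp m, R.rp m}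
        rw [h1, h2, hr]
      rw [starMat, Matrix.of_apply, if_pos hp, one_mul, ← R.cochain_vm_vp x m, h1, h2]
    · have hp : Surface.posCell h = R.cellMinus m := by
        have hr : d = R.rm m := Γ.pos_coherent a b _ _ h (h1 ▸ h2 ▸ R.pos_minus m)
        apply Subtype.ext
        change ({a, b, d} : Finset E3) = {R.vp m, R.vm m, R.rm m}
        rw [h1, h2, hr]
      rw [starMat, Matrix.of_apply, if_neg (hp ▸ (R.cellPlus_ne_cellMinus m).symm), if_pos hp,
        ← R.cochain_vm_vp x m, h1, h2, R.cochain_antisymm x b a]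
      ring
  have hc2 : Surface.posCell h2 = Surface.posCell h := Subtype.ext (by
    change ({b, d, a} : Finset E3) = {a, b, d}
    ext y; simp; tauto)
  have hc3 : Surface.posCell h3 = Surface.posCell h := Subtype.ext (by
    change ({d, a, b} : Finset E3) = {a, b, d}
    ext y; simp; tauto)
  have k1 := key h
  have k2 := key h2
  have k3 := key h3
  rw [hc2] at k2
  rw [hc3] at k3
  -- A nonzero entry of `Σ` in the column of this cell requires the edge to be a side of it, so only
  -- three terms of the sum survive.
  have hmem : ∀ m : Γ.Edge, (m : Finset E3) ⊆ {a, b, d} →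
      m = Surface.posEdge h ∨ m = Surface.posEdge h2 ∨ m = Surface.posEdge h3 := by
    intro m hm
    obtain ⟨y, z, hyz, hyz'⟩ := Finset.card_eq_two.1 m.2.2
    have hy : y ∈ ({a, b, d} : Finset E3) := hm (by simp [hyz'])
    have hz : z ∈ ({a, b, d} : Finset E3) := hm (by simp [hyz'])
    simp only [Finset.mem_insert, Finset.mem_singleton] at hy hz
    have e1 : ∀ m' : Γ.Edge, (m : Finset E3) = m' → m = m' := fun _ h => Subtype.ext h
    rcases hy with rfl | rfl | rfl <;> rcases hz with rfl | rfl | rfl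
    · exact absurd rfl hyz
    · exact Or.inl (e1 _ hyz')
    · exact Or.inr (Or.inr (e1 _ (by rw [hyz', Finset.pair_comm]; rfl)))
    · exact Or.inl (e1 _ (by rw [hyz', Finset.pair_comm]; rfl))
    · exact absurd rfl hyz
    · exact Or.inr (Or.inl (e1 _ hyz'))
    · exact Or.inr (Or.inr (e1 _ hyz'))
    · exact Or.inr (Or.inl (e1 _ (by rw [hyz', Finset.pair_comm]; rfl)))
    · exact absurd rfl hyz
  have hne12 : Surface.posEdge h ≠ Surface.posEdge h2 := by
    intro hh
    have hh' : ({a, b} : Finset E3) = {b, d} := congrArg Subtype.val hh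
    have : a ∈ ({b, d} : Finset E3) := hh' ▸ by simp
    simp [hab, had] at this
  have hne13 : Surface.posEdge h ≠ Surface.posEdge h3 := by
    intro hh
    have hh' : ({a, b} : Finset E3) = {d, a} := congrArg Subtype.val hh
    have : b ∈ ({d, a} : Finset E3) := hh' ▸ by simp
    simp [hab.symm, hbd] at this
  have hne23 : Surface.posEdge h2 ≠ Surface.posEdge h3 := by
    intro hh
    have hh' : ({b, d} : Finset E3) = {d, a} := congrArg Subtype.val hh
    have : b ∈ ({d, a} : Finset E3) := hh' ▸ by simp
    simp [hab.symm, hbd] at this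
  rw [← k1, ← k2, ← k3, add_assoc]
  simp only [mulVec, dotProduct, transpose_apply]
  rw [← Finset.sum_subset (Finset.subset_univ
    {Surface.posEdge h, Surface.posEdge h2, Surface.posEdge h3}),
    Finset.sum_insert, Finset.sum_pair hne23]
  · simp [hne12, hne13]
  · intro m _ hm
    have hsub : ¬ (m : Finset E3) ⊆ {a, b, d} := fun hh => hm (by simpa using hmem m hh)
    rw [starMat, Matrix.of_apply, if_neg, if_neg, zero_mul]
    · intro hh
      apply hsub
      have : ({a, b, d} : Finset E3) = {R.vp m, R.vm m, R.rm m} := congrArg Subtype.val hh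
      rw [this, R.edge_eq]
      intro y; simp; tauto
    · intro hh
      apply hsub
      have : ({a, b, d} : Finset E3) = {R.vm m, R.vp m, R.rp m} := congrArg Subtype.val hh
      rw [this, R.edge_eq]
      intro y; simp; tauto

lemma isClosedCochain_of_starMat {x : Γ.Edge → ℝ} (hx : R.starMatᵀ *ᵥ x = 0) :
    R.IsClosedCochain x := fun a b d h => by
  rw [← R.starMat_transpose_mulVec x h, hx]; rfl

/-- The vertex `v⁺` of an edge. -/
def vertexPlus (m : Γ.Edge) : Γ.Vertex :=
  ⟨R.vp m, Surface.mem_vertices_of_mem_cell (R.cellPlus m) (by simp [cellPlus])⟩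

/-- The vertex `v⁻` of an edge. -/
def vertexMinus (m : Γ.Edge) : Γ.Vertex :=
  ⟨R.vm m, Surface.mem_vertices_of_mem_cell (R.cellPlus m) (by simp [cellPlus])⟩

lemma loopMat_mulVec (l : Γ.Vertex → ℝ) (m : Γ.Edge) :
    (R.loopMat *ᵥ l) m = l (R.vertexPlus m) - l (R.vertexMinus m) := by
  have hne : R.vertexPlus m ≠ R.vertexMinus m := fun h => R.vp_ne_vm m (congrArg Subtype.val h)
  have hval : ∀ n, R.loopMat m n * l n =
      (if n = R.vertexPlus m then l n else 0) - (if n = R.vertexMinus m then l n else 0) := by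
    intro n
    have h1 : (n : E3) = R.vp m ↔ n = R.vertexPlus m := (Subtype.ext_iff (a2 := R.vertexPlus m)).symm
    have h2 : (n : E3) = R.vm m ↔ n = R.vertexMinus m := (Subtype.ext_iff (a2 := R.vertexMinus m)).symm
    rw [loopMat, Matrix.of_apply]
    simp only [h1, h2]
    split_ifs with h3 h4
    · exact absurd (h3.symm.trans h4) hne
    all_goals simp
  simp only [mulVec, dotProduct, hval, Finset.sum_sub_distrib, Finset.sum_ite_eq',
    Finset.mem_univ, if_true]

lemma starMat_mulVec (s : Γ.Cell → ℝ) (m : Γ.Edge) :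
    (R.starMat *ᵥ s) m = s (R.cellPlus m) - s (R.cellMinus m) := by
  have hne := R.cellPlus_ne_cellMinus m
  have hval : ∀ n, R.starMat m n * s n =
      (if n = R.cellPlus m then s n else 0) - (if n = R.cellMinus m then s n else 0) := by
    intro n
    rw [starMat, Matrix.of_apply]
    split_ifs with h3 h4
    · exact absurd (h3.symm.trans h4) hne
    all_goals simp
  simp only [mulVec, dotProduct, hval, Finset.sum_sub_distrib, Finset.sum_ite_eq',
    Finset.mem_univ, if_true]

/-- The vertex `d` only certifies that `a` and `b` span an edge; antisymmetry makes the difference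
independent of how that edge is labelled. -/
lemma cochain_loopMat (l : Γ.Vertex → ℝ) {a b d : E3} (h : Γ.pos a b d)
    (ha : a ∈ Γ.K.vertices) (hb : b ∈ Γ.K.vertices) :
    R.cochain (R.loopMat *ᵥ l) a b = l ⟨b, hb⟩ - l ⟨a, ha⟩ := by
  set m := Surface.posEdge h with hm
  have he : ({a, b} : Finset E3) = {R.vp m, R.vm m} := R.edge_eq m
  have hab := (Surface.pos_ne h).1
  have hcv := R.cochain_vm_vp (R.loopMat *ᵥ l) m
  rw [loopMat_mulVec] at hcv
  have ha' : a ∈ ({R.vp m, R.vm m} : Finset E3) := he ▸ by simp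
  have hb' : b ∈ ({R.vp m, R.vm m} : Finset E3) := he ▸ by simp
  simp only [Finset.mem_insert, Finset.mem_singleton] at ha' hb'
  rcases ha' with h1 | h1 <;> rcases hb' with h2 | h2
  · exact absurd (h1.trans h2.symm) hab
  · have e1 : R.vertexPlus m = ⟨a, ha⟩ := Subtype.ext h1.symm
    have e2 : R.vertexMinus m = ⟨b, hb⟩ := Subtype.ext h2.symm
    rw [e1, e2, ← h1, ← h2] at hcv
    rw [cochain_antisymm, hcv]
    ring
  · have e1 : R.vertexPlus m = ⟨b, hb⟩ := Subtype.ext h2.symm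
    have e2 : R.vertexMinus m = ⟨a, ha⟩ := Subtype.ext h1.symm
    rw [e1, e2, ← h1, ← h2] at hcv
    exact hcv
  · exact absurd (h1.trans h2.symm) hab

/-- The three potential differences around a triangle telescope. -/
lemma starMat_transpose_mul_loopMat : R.starMatᵀ * R.loopMat = 0 := by
  apply Matrix.ext_of_mulVec_single
  intro v
  rw [← mulVec_mulVec, zero_mulVec]
  ext t
  obtain ⟨a, b, d, h, ht⟩ := Surface.exists_pos t
  obtain rfl : t = Surface.posCell h := Subtype.ext ht
  have hv : ∀ y ∈ ({a, b, d} : Finset E3), y ∈ Γ.K.vertices :=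
    fun y hy => Surface.mem_vertices_of_mem_cell (Surface.posCell h) hy
  have h2 := Γ.pos_cyclic _ _ _ h
  have h3 := Γ.pos_cyclic _ _ _ h2
  rw [starMat_transpose_mulVec, R.cochain_loopMat _ h (hv a (by simp)) (hv b (by simp)),
    R.cochain_loopMat _ h2 (hv b (by simp)) (hv d (by simp)),
    R.cochain_loopMat _ h3 (hv d (by simp)) (hv a (by simp))]
  simp

end Labels

namespace Surface

variable {Γ : Surface}

/-! ### Connectedness -/

/-- On a connected surface, a function of the cells that takes equal values on cells with a common
vertex is constant. -/
lemma cell_const_of_connected (hΓ : IsPreconnected Γ.carrier) {β : Type*} (g : Γ.Cell → β)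
    (hg : ∀ (s t : Γ.Cell) (y : E3), y ∈ (s : Finset E3) → y ∈ (t : Finset E3) → g s = g t)
    (s t : Γ.Cell) : g s = g t := by
  by_contra hst
  -- The cells on which `g` takes the value `g s` and the remaining ones form two nonempty closed
  -- sets that cover the surface; by connectedness they meet.
  let S : Set E3 := ⋃ u ∈ {u : Γ.Cell | g u = g s}, convexHull ℝ ((u : Finset E3) : Set E3)
  let T : Set E3 := ⋃ u ∈ {u : Γ.Cell | g u ≠ g s}, convexHull ℝ ((u : Finset E3) : Set E3)
  have hS : IsClosed S := Set.Finite.isClosed_biUnion (Set.toFinite _)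
    fun u _ => isClosed_convexHull_cell u
  have hT : IsClosed T := Set.Finite.isClosed_biUnion (Set.toFinite _)
    fun u _ => isClosed_convexHull_cell u
  have hne : ∀ u : Γ.Cell, ∃ r, r ∈ convexHull ℝ ((u : Finset E3) : Set E3) := fun u => by
    obtain ⟨y, hy⟩ := Γ.K.nonempty_of_mem_faces u.2.1
    exact ⟨y, subset_convexHull ℝ _ hy⟩
  have hcov : Γ.carrier ⊆ S ∪ T := by
    intro r hr
    obtain ⟨u, hu⟩ := mem_carrier_iff.1 hr
    by_cases h : g u = g s
    · exact Or.inl (Set.mem_biUnion h hu)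
    · exact Or.inr (Set.mem_biUnion h hu)
  obtain ⟨r, -, hrS, hrT⟩ := isPreconnected_closed_iff.1 hΓ S T hS hT hcov
    (by obtain ⟨r, hr⟩ := hne s
        exact ⟨r, convexHull_cell_subset s hr,
          Set.mem_biUnion (show s ∈ {u : Γ.Cell | g u = g s} from rfl) hr⟩)
    (by obtain ⟨r, hr⟩ := hne t
        exact ⟨r, convexHull_cell_subset t hr,
          Set.mem_biUnion (show t ∈ {u : Γ.Cell | g u ≠ g s} from fun h => hst h.symm) hr⟩)
  simp only [S, T, Set.mem_iUnion, Set.mem_ofPred_eq] at hrS hrT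
  obtain ⟨u, hu, hru⟩ := hrS
  obtain ⟨u', hu', hru'⟩ := hrT
  -- In a simplicial complex, cells that share a point share a vertex, where `hg` gives the
  -- contradiction.
  have hr := Γ.K.inter_subset_convexHull u.2.1 u'.2.1 ⟨hru, hru'⟩
  obtain ⟨y, hy1, hy2⟩ := convexHull_nonempty_iff.1 ⟨r, hr⟩
  exact hu' ((hg u' u y hy2 hy1).trans hu)

end Surface

namespace Labels

variable {Γ : Surface} {R : Labels Γ}

/-- Any two vertices of a cell span an edge, so a potential with zero gradient is constant on each
cell. Its values there form a function of cells that agrees on cells with a common vertex. -/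
lemma eq_of_loopMat_mulVec_eq_zero (hΓ : IsPreconnected Γ.carrier) {l : Γ.Vertex → ℝ}
    (hl : R.loopMat *ᵥ l = 0) (v w : Γ.Vertex) : l v = l w := by
  have hcell : ∀ (t : Γ.Cell) (v w : Γ.Vertex), (v : E3) ∈ (t : Finset E3) →
      (w : E3) ∈ (t : Finset E3) → l v = l w := by
    intro t v w hv hw
    by_cases hvw : v = w
    · rw [hvw]
    have hvw' : (v : E3) ≠ w := fun h => hvw (Subtype.ext h)
    obtain ⟨y, hy⟩ : ((t : Finset E3) \ {(v : E3), (w : E3)}).Nonempty := by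
      rw [← Finset.card_pos]
      have := Finset.le_card_sdiff ({(v : E3), (w : E3)} : Finset E3) t
      rw [t.2.2, Finset.card_pair hvw'] at this
      omega
    simp only [Finset.mem_sdiff, Finset.mem_insert, Finset.mem_singleton, not_or] at hy
    have h0 : ∀ a b, R.cochain (R.loopMat *ᵥ l) a b = 0 := fun a b => by
      rw [hl]
      exact Finset.sum_eq_zero fun m _ => by simp
    rcases (Surface.exists_pos_of_distinct t hv hw hy.1 hvw' (Ne.symm hy.2.1)
      (Ne.symm hy.2.2)).2 with h | h
    · have := R.cochain_loopMat l h v.2 w.2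
      rw [h0] at this
      linarith
    · have := R.cochain_loopMat l h w.2 v.2
      rw [h0] at this
      linarith
  have hex : ∀ t : Γ.Cell, ∃ v : Γ.Vertex, (v : E3) ∈ (t : Finset E3) := fun t => by
    obtain ⟨y, hy⟩ := Γ.K.nonempty_of_mem_faces t.2.1
    exact ⟨⟨y, Surface.mem_vertices_of_mem_cell t hy⟩, hy⟩
  choose f hf using hex
  obtain ⟨s, hs⟩ := Surface.exists_cell_of_vertex v
  obtain ⟨t, ht⟩ := Surface.exists_cell_of_vertex w
  rw [hcell s v (f s) hs (hf s), hcell t w (f t) ht (hf t)]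
  refine Surface.cell_const_of_connected hΓ (fun t => l (f t)) (fun s t y hys hyt => ?_) s t
  have hy := Surface.mem_vertices_of_mem_cell s hys
  exact (hcell s (f s) ⟨y, hy⟩ (hf s) hys).trans (hcell t ⟨y, hy⟩ (f t) hyt (hf t))

/-- The values agree across every edge, hence along the chain of cells around a vertex given by
`star_connected`, hence on all cells with a common vertex. The chain is what excludes pinch points,
which would not disconnect the surface but would separate cells. -/
lemma eq_of_starMat_mulVec_eq_zero (hΓ : IsPreconnected Γ.carrier) {s : Γ.Cell → ℝ}
    (hs : R.starMat *ᵥ s = 0) (t t' : Γ.Cell) : s t = s t' := by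
  have hadj : ∀ t t' : Γ.Cell, ((t : Finset E3) ∩ t').card = 2 → s t = s t' := by
    intro t t' h
    have hface : (t : Finset E3) ∩ t' ∈ Γ.K.faces :=
      Γ.K.down_closed t.2.1 Finset.inter_subset_left (Finset.card_pos.1 (by omega))
    set m : Γ.Edge := ⟨(t : Finset E3) ∩ t', hface, h⟩ with hm
    have hpm : s (R.cellPlus m) = s (R.cellMinus m) := by
      have := congrFun hs m
      rw [starMat_mulVec] at this
      exact sub_eq_zero.1 this
    obtain ⟨x, y, -, hxy⟩ := Set.ncard_eq_two.1 (Γ.edge_two_cells m m.2.1 m.2.2)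
    have hsubp : (m : Finset E3) ⊆ R.cellPlus m := by
      rw [R.edge_eq m]; intro z; simp [cellPlus]; tauto
    have hsubm : (m : Finset E3) ⊆ R.cellMinus m := by
      rw [R.edge_eq m]; intro z; simp [cellMinus]; tauto
    have hmem : ∀ u : Γ.Cell, (m : Finset E3) ⊆ u → (u : Finset E3) = x ∨ (u : Finset E3) = y := by
      intro u hu
      have : (u : Finset E3) ∈ ({x, y} : Set (Finset E3)) := hxy ▸ ⟨u.2.1, u.2.2, hu⟩
      simpa using this
    have hne : (R.cellPlus m : Finset E3) ≠ R.cellMinus m :=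
      fun h => R.cellPlus_ne_cellMinus m (Subtype.ext h)
    -- The edge lies in exactly two cells, and `c⁺`, `c⁻` are two distinct ones.
    have hval : ∀ u : Γ.Cell, (m : Finset E3) ⊆ u → s u = s (R.cellPlus m) := by
      intro u hu
      have : u = R.cellPlus m ∨ u = R.cellMinus m := by
        rw [Subtype.ext_iff, Subtype.ext_iff]
        rcases hmem u hu with h1 | h1 <;> rcases hmem _ hsubp with h2 | h2 <;>
          rcases hmem _ hsubm with h3 | h3 <;> simp_all
      rcases this with rfl | rfl
      · rfl
      · exact hpm.symm
    rw [hval t Finset.inter_subset_left, hval t' Finset.inter_subset_right]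
  refine Surface.cell_const_of_connected hΓ s (fun t t' y hy hy' => ?_) t t'
  have hchain := Γ.star_connected y t t.2.1 t' t'.2.1 t.2.2 t'.2.2 hy hy'
  have : ∀ b : Finset E3, Relation.ReflTransGen
      (fun a b : Finset E3 => b ∈ Γ.K.faces ∧ b.card = 3 ∧ y ∈ b ∧ (a ∩ b).card = 2) t b →
      ∃ h : b ∈ Γ.K.faces ∧ b.card = 3, s ⟨b, h⟩ = s t := by
    intro b hb
    induction hb with
    | refl => exact ⟨t.2, rfl⟩
    | tail _ h ih =>
      obtain ⟨h1, h2⟩ := ih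
      exact ⟨⟨h.1, h.2.1⟩, by rw [← h2]; exact (hadj ⟨_, h1⟩ ⟨_, h.1, h.2.1⟩ h.2.2.2).symm⟩
  obtain ⟨_, h⟩ := this t' hchain
  exact h.symm

/-! ### Closed cochains are exact on a simply connected surface -/

/-- Local integration from a base vertex of each cell is ambiguous only by integers, so it defines a
global map to the circle. This map sends all vertices to zero and winds `x m` times along the edge
`m`; on a simply connected surface it has a real potential. -/
lemma exists_potential_int [SimplyConnectedSpace Γ.carrier] {x : Γ.Edge → ℤ}
    (hx : R.IsClosedCochain x) :
    ∃ l : Γ.Vertex → ℝ, ∀ m, (x m : ℝ) = l (R.vertexPlus m) - l (R.vertexMinus m) := by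
  choose A hA hAw using fun t : Γ.Cell => exists_continuous_coords_finset (Γ.K.indep t.2.1)
  choose o ho using fun t : Γ.Cell => Γ.K.nonempty_of_mem_faces t.2.1
  -- Affine on the cell `t`, with value at each vertex `y` equal to the integral of `x` from the
  -- base vertex `o t` to `y`.
  let f : Γ.Cell → E3 → ℝ := fun t r => ∑ y ∈ (t : Finset E3), A t r y * (R.cochain x (o t) y : ℤ)
  have hf : ∀ t, Continuous (f t) := fun t =>
    continuous_finsetSum _ fun y _ => (hA t y).mul continuous_const
  have hfw : ∀ (t : Γ.Cell) (w : E3 → ℝ), ∑ y ∈ (t : Finset E3), w y = 1 →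
      f t (∑ y ∈ (t : Finset E3), w y • y) =
        ∑ y ∈ (t : Finset E3), w y * (R.cochain x (o t) y : ℤ) := fun t w hw =>
    Finset.sum_congr rfl fun y hy => by rw [hAw t w hw y hy]
  have hfv : ∀ (t : Γ.Cell) (y : E3), y ∈ (t : Finset E3) → f t y = (R.cochain x (o t) y : ℤ) := by
    intro t y hy
    have := hfw t (fun z => if z = y then 1 else 0) (by simp [hy])
    simpa [hy] using this
  have hfint : ∀ (s t : Γ.Cell) (r : E3), r ∈ convexHull ℝ ((s : Finset E3) : Set E3) →
      r ∈ convexHull ℝ ((t : Finset E3) : Set E3) →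
      (f s r : AddCircle (1 : ℝ)) = (f t r : AddCircle (1 : ℝ)) := by
    intro s t r hs ht
    have hr := Γ.K.inter_subset_convexHull s.2.1 t.2.1 ⟨hs, ht⟩
    rw [← Finset.coe_inter, Finset.mem_convexHull'] at hr
    obtain ⟨w, -, hw1, rfl⟩ := hr
    set J := (s : Finset E3) ∩ t with hJ
    -- Weights on the common face, extended by zero to the vertices of either cell.
    let w' : E3 → ℝ := fun y => if y ∈ J then w y else 0
    have hext : ∀ (u : Finset E3), J ⊆ u → ∀ {M : Type} [AddCommGroup M] [Module ℝ M]
        (F : E3 → M), ∑ y ∈ u, w' y • F y = ∑ y ∈ J, w y • F y := by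
      intro u hu M _ _ F
      simp only [w', ite_smul, zero_smul, ← Finset.sum_filter]
      congr 1
      ext y
      simp only [Finset.mem_filter]
      exact ⟨fun h => h.2, fun h => ⟨hu h, h⟩⟩
    have hval : ∀ u : Γ.Cell, J ⊆ (u : Finset E3) → f u (∑ y ∈ J, w y • y) =
        ∑ y ∈ J, w y * (R.cochain x (o u) y : ℤ) := by
      intro u hu
      have h1 := hext u hu (fun y => y)
      have h2 := hext u hu (fun _ => (1 : ℝ))
      have h3 := hext u hu (fun y => ((R.cochain x (o u) y : ℤ) : ℝ))
      simp only [smul_eq_mul, mul_one] at h2 h3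
      rw [← h1, hfw u w' (h2.trans hw1), h3]
    have hJne : J.Nonempty := by
      rw [Finset.nonempty_iff_ne_empty]
      rintro h
      rw [h] at hw1
      simp at hw1
    obtain ⟨y₀, hy₀⟩ := hJne
    have hy₀' := Finset.mem_inter.1 hy₀
    -- At every common vertex the two integrals differ by the same integer, because `y₀` can be
    -- inserted as an intermediate point in both cells; since the weights sum to one, this is also
    -- the difference at the given point.
    have hdiff : f s (∑ y ∈ J, w y • y) - f t (∑ y ∈ J, w y • y) =
        ((R.cochain x (o s) y₀ - R.cochain x (o t) y₀ : ℤ) : ℝ) := by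
      rw [hval s Finset.inter_subset_left, hval t Finset.inter_subset_right,
        ← Finset.sum_sub_distrib]
      calc ∑ y ∈ J, (w y * (R.cochain x (o s) y : ℤ) - w y * (R.cochain x (o t) y : ℤ))
          = ∑ y ∈ J, w y * ((R.cochain x (o s) y₀ - R.cochain x (o t) y₀ : ℤ) : ℝ) := by
            refine Finset.sum_congr rfl fun y hy => ?_
            have hy' := Finset.mem_inter.1 hy
            rw [← hx.add_eq s (ho s) hy₀'.1 hy'.1, ← hx.add_eq t (ho t) hy₀'.2 hy'.2]
            push_cast
            ring
        _ = _ := by rw [← Finset.sum_mul, hw1, one_mul]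
    rw [← sub_eq_zero, ← AddCircle.coe_sub, hdiff, AddCircle.coe_eq_zero_iff]
    exact ⟨R.cochain x (o s) y₀ - R.cochain x (o t) y₀, by simp⟩
  choose c hc using fun r : Γ.carrier => Surface.mem_carrier_iff.1 r.2
  let u : Γ.carrier → AddCircle (1 : ℝ) := fun r => (f (c r) r : ℝ)
  have hu : ∀ (t : Γ.Cell) (r : Γ.carrier), (r : E3) ∈ convexHull ℝ ((t : Finset E3) : Set E3) →
      u r = (f t r : ℝ) := fun t r hr => hfint _ _ _ (hc r) hr
  have hucont : Continuous u := by
    -- Continuity is checked on the finite closed cover by cells, on each of which `u` is the class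
    -- of a continuous real function.
    refine (locallyFinite_of_finite fun t : Γ.Cell =>
      (Subtype.val ⁻¹' convexHull ℝ ((t : Finset E3) : Set E3) : Set Γ.carrier)).continuous
      ?_ (fun t => (Surface.isClosed_convexHull_cell t).preimage continuous_subtype_val)
      fun t => ?_
    · rw [Set.iUnion_eq_univ_iff]
      exact fun r => ⟨c r, hc r⟩
    · refine ContinuousOn.congr (f := fun r : Γ.carrier => ((f t r : ℝ) : AddCircle (1 : ℝ)))
        (Continuous.continuousOn ?_) fun r hr => hu t r hr
      exact (AddCircle.continuous_mk' 1).comp ((hf t).comp continuous_subtype_val)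
  obtain ⟨l, hl⟩ := exists_potential_of_continuous_addCircle hucont
  refine ⟨fun v => l ⟨v, Γ.K.vertices_subset_space v.2⟩, fun m => ?_⟩
  set t := R.cellPlus m with ht
  have hm : R.vm m ∈ (t : Finset E3) := by simp [ht, cellPlus]
  have hp : R.vp m ∈ (t : Finset E3) := by simp [ht, cellPlus]
  have hseg : ∀ τ : unitInterval, AffineMap.lineMap (R.vm m) (R.vp m) (τ : ℝ) ∈
      convexHull ℝ ((t : Finset E3) : Set E3) := fun τ =>
    (convex_convexHull ℝ _).lineMap_mem (subset_convexHull ℝ _ hm) (subset_convexHull ℝ _ hp) τ.2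
  let p : Path (X := Γ.carrier) ⟨R.vertexMinus m, Γ.K.vertices_subset_space (R.vertexMinus m).2⟩
      ⟨R.vertexPlus m, Γ.K.vertices_subset_space (R.vertexPlus m).2⟩ :=
    { toFun := fun τ => ⟨AffineMap.lineMap (R.vm m) (R.vp m) (τ : ℝ),
        Surface.convexHull_cell_subset t (hseg τ)⟩
      continuous_toFun := by
        refine Continuous.subtype_mk ?_ _
        exact AffineMap.lineMap_continuous.comp continuous_subtype_val
      source' := Subtype.ext (by simp [vertexMinus])
      target' := Subtype.ext (by simp [vertexPlus]) }
  -- Along an edge of `t` the function `f t` is itself a real lift of `u`, so the potential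
  -- increment is the difference of its end values.
  have key := hl _ _ p ⟨fun τ => f t (p τ), by fun_prop⟩ fun τ => (hu t (p τ) (hseg τ)).symm
  rw [key]
  simp only [ContinuousMap.coe_mk, Path.target, Path.source]
  change (x m : ℝ) = f t (R.vp m) - f t (R.vm m)
  rw [hfv t _ hm, hfv t _ hp, ← hx.add_eq t (ho t) hm hp, R.cochain_vm_vp]
  push_cast
  ring

lemma IsClosedCochain.comp {A B : Type*} [AddCommGroup A] [AddCommGroup B] {x : Γ.Edge → A}
    (hx : R.IsClosedCochain x) (φ : A →+ B) : R.IsClosedCochain fun m => φ (x m) := by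
  intro a b d h
  rw [cochain_comp, cochain_comp, cochain_comp, ← map_add, ← map_add, hx a b d h, map_zero]

/-- On a simply connected surface, an edge vector without circulation around the cells is a
combination of loops. -/
lemma exists_loopMat_mulVec_eq [SimplyConnectedSpace Γ.carrier] {x : Γ.Edge → ℝ}
    (hx : R.starMatᵀ *ᵥ x = 0) : ∃ l, R.loopMat *ᵥ l = x := by
  have hx := R.isClosedCochain_of_starMat hx
  -- The group generated by the entries of `x` is finitely generated and torsion-free, hence free,
  -- and circulations can be computed in it.
  let M : Submodule ℤ ℝ := Submodule.span ℤ (Set.range x)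
  have : Module.Finite ℤ M := Module.Finite.span_of_finite ℤ (Set.finite_range x)
  let b := Module.Free.chooseBasis ℤ M
  let x' : Γ.Edge → M := fun m => ⟨x m, Submodule.subset_span ⟨m, rfl⟩⟩
  have hx' : R.IsClosedCochain x' := by
    intro p q r h
    apply Subtype.ext
    have := hx p q r h
    have hφ := fun p q => R.cochain_comp M.subtype.toAddMonoidHom x' p q
    change ∀ p q, R.cochain x p q = ((R.cochain x' p q : M) : ℝ) at hφ
    rw [hφ, hφ, hφ] at this
    exact this
  choose l hl using fun j => exists_potential_int (hx'.comp (b.coord j).toAddMonoidHom)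
  -- The potentials of the integer coordinates are recombined with the real numbers that form the
  -- basis.
  refine ⟨fun v => ∑ j, l j v * (b j : ℝ), ?_⟩
  ext m
  rw [loopMat_mulVec, ← Finset.sum_sub_distrib]
  have h1 : (∑ j, (b.repr (x' m) j) • b j : M) = x' m := b.sum_repr (x' m)
  have h2 := congrArg (fun z : M => (z : ℝ)) h1
  simp only [Submodule.coe_sum, Submodule.coe_smul, zsmul_eq_mul] at h2
  rw [show x m = ((x' m : M) : ℝ) from rfl, ← h2]
  refine Finset.sum_congr rfl fun j _ => ?_
  rw [← sub_mul]
  congr 1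
  exact (hl j m).symm

/-- Exactness identifies the range of `Λ` with the kernel of `Σᵀ`, and `Σᵀ` has the rank of `Σ`; the
identity is rank-nullity for `Σᵀ`. -/
lemma rank_loopMat_add_rank_starMat [SimplyConnectedSpace Γ.carrier] :
    R.loopMat.rank + R.starMat.rank = Fintype.card Γ.Edge := by
  have h : LinearMap.range R.loopMat.mulVecLin = LinearMap.ker R.starMatᵀ.mulVecLin := by
    apply le_antisymm
    · rintro _ ⟨l, rfl⟩
      rw [LinearMap.mem_ker, mulVecLin_apply, mulVecLin_apply, mulVec_mulVec,
        starMat_transpose_mul_loopMat, zero_mulVec]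
    · intro x hx
      obtain ⟨l, hl⟩ := exists_loopMat_mulVec_eq (R := R) hx
      exact ⟨l, hl⟩
  have := LinearMap.finrank_range_add_finrank_ker R.starMatᵀ.mulVecLin
  rw [Module.finrank_fintype_fun_eq_card, ← h] at this
  change R.starMatᵀ.rank + R.loopMat.rank = _ at this
  rw [rank_transpose] at this
  omega

lemma loopMat_mulVec_one : R.loopMat *ᵥ 1 = 0 := by
  ext m; rw [loopMat_mulVec]; simp

lemma starMat_mulVec_one : R.starMat *ᵥ 1 = 0 := by
  ext m; rw [starMat_mulVec]; simp

end Labels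

/-! ### Triangles and the surface measure -/

section Triangle

/-- Affine parametrization of a triangle by a subset of the plane. -/
noncomputable def triangleMap (y : Fin 3 → E3) (p : ℝ × ℝ) : E3 :=
  ∑ k, (![1 - p.1 - p.2, p.1, p.2] : Fin 3 → ℝ) k • y k

/-- The map is a translate of an injective linear map between finite-dimensional spaces. The upper
bound makes triangles have finite area, the lower bound makes images of open sets have positive
area. -/
lemma triangleMap_lipschitz {y : Fin 3 → E3} (hy : AffineIndependent ℝ y) :
    (∃ K, LipschitzWith K (triangleMap y)) ∧ ∃ K, AntilipschitzWith K (triangleMap y) := by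
  let L : ℝ × ℝ →L[ℝ] E3 := (ContinuousLinearMap.fst ℝ ℝ ℝ).smulRight (y 1 - y 0) +
    (ContinuousLinearMap.snd ℝ ℝ ℝ).smulRight (y 2 - y 0)
  have hL : triangleMap y = fun p => y 0 + L p := by
    ext1 p
    simp only [triangleMap, L, Fin.sum_univ_three, _root_.add_apply,
      ContinuousLinearMap.smulRight_apply, ContinuousLinearMap.coe_fst',
      ContinuousLinearMap.coe_snd', Matrix.cons_val_zero, Matrix.cons_val_one,
      Matrix.cons_val_two, Matrix.tail_cons, Matrix.head_cons]
    module
  have hker : LinearMap.ker (L : ℝ × ℝ →ₗ[ℝ] E3) = ⊥ := by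
    rw [LinearMap.ker_eq_bot']
    rintro ⟨a, b⟩ hab
    -- A kernel vector would give the corner `y 0` a second set of barycentric coordinates.
    have hab' : y 0 + L (a, b) = y 0 + L (0, 0) := by
      rw [show L (a, b) = 0 from hab, show ((0 : ℝ), (0 : ℝ)) = 0 from rfl, map_zero]
    have h := congrFun hL
    rw [← h, ← h] at hab'
    have := eq_of_sum_smul_eq hy (by simp [Fin.sum_univ_three]; ring)
      (by simp [Fin.sum_univ_three]) hab'
    have h1 := congrFun this 1
    have h2 := congrFun this 2
    simp at h1 h2
    rw [h1, h2]; rfl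
  obtain ⟨K, -, hK⟩ := LinearMap.exists_antilipschitzWith (L : ℝ × ℝ →ₗ[ℝ] E3) hker
  rw [hL]
  exact ⟨⟨_, (isometry_add_left (y 0)).lipschitz.comp L.lipschitz⟩,
    ⟨_, (isometry_add_left (y 0)).antilipschitz.comp hK⟩⟩

/-- The two measures differ by a nonzero finite factor. -/
lemma euclideanHausdorffMeasure_two_eq_zero_iff {s : Set E3} :
    (μHE[2] : Measure E3) s = 0 ↔ (μH[2] : Measure E3) s = 0 := by
  rw [Measure.euclideanHausdorffMeasure_def, Measure.smul_apply, ENNReal.smul_def, smul_eq_mul,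
    mul_eq_zero, ENNReal.coe_eq_zero]
  have h := Measure.addHaarScalarFactor_volume_hausdorffMeasure_ne_zero 2
  simp only [Nat.cast_ofNat] at h ⊢
  exact ⟨fun h' => h'.resolve_left h, Or.inr⟩

lemma euclideanHausdorffMeasure_two_lt_top {s : Set E3} (h : (μH[2] : Measure E3) s < ⊤) :
    (μHE[2] : Measure E3) s < ⊤ := by
  rw [Measure.euclideanHausdorffMeasure_def, Measure.smul_apply, ENNReal.smul_def, smul_eq_mul]
  exact ENNReal.mul_lt_top ENNReal.coe_lt_top (by simpa using h)

/-- The antilipschitz bound controls the Hausdorff measure of `U` by that of its image, and on the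
plane this measure is Lebesgue measure. -/
lemma measure_image_triangleMap_ne_zero {y : Fin 3 → E3} (hy : AffineIndependent ℝ y)
    {U : Set (ℝ × ℝ)} (hU : IsOpen U) (hne : U.Nonempty) :
    (μHE[2] : Measure E3) (triangleMap y '' U) ≠ 0 := by
  rw [Ne, euclideanHausdorffMeasure_two_eq_zero_iff]
  intro h0
  obtain ⟨K, hK⟩ := (triangleMap_lipschitz hy).2
  have := hK.le_hausdorffMeasure_image (d := 2) (by norm_num) U
  rw [h0, mul_zero, hausdorffMeasure_prod_real] at this
  exact (hU.measure_pos volume hne).ne' (le_antisymm this bot_le)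

lemma measure_convexHull_triangle_lt_top {y : Fin 3 → E3} (hy : AffineIndependent ℝ y) :
    (μHE[2] : Measure E3) (convexHull ℝ (Set.range y)) < ⊤ := by
  apply euclideanHausdorffMeasure_two_lt_top
  obtain ⟨K, hK⟩ := (triangleMap_lipschitz hy).1
  have hsub : convexHull ℝ (Set.range y) ⊆ triangleMap y '' (Set.Icc (0 : ℝ × ℝ) (1, 1)) := by
    intro r hr
    obtain ⟨w, h0, h1, rfl⟩ := mem_convexHull_range_iff.1 hr
    rw [Fin.sum_univ_three] at h1
    have e0 := h0 0
    have e1 := h0 1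
    have e2 := h0 2
    refine ⟨(w 1, w 2), ⟨⟨e1, e2⟩, ⟨?_, ?_⟩⟩, ?_⟩
    · change w 1 ≤ 1; linarith
    · change w 2 ≤ 1; linarith
    · rw [triangleMap]
      refine Finset.sum_congr rfl fun k _ => ?_
      congr 1
      fin_cases k
      · simp; linarith
      · rfl
      · rfl
  refine (measure_mono hsub).trans_lt
    ((hK.hausdorffMeasure_image_le (d := 2) (by norm_num) _).trans_lt ?_)
  rw [hausdorffMeasure_prod_real]
  exact ENNReal.mul_lt_top (by simp) isCompact_Icc.measure_lt_top

variable {ι : Type*} [Fintype ι]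

lemma exists_reindex_three (hι : Fintype.card ι = 3) {y : ι → E3} (hy : AffineIndependent ℝ y) :
    ∃ e : Fin 3 ≃ ι, AffineIndependent ℝ (y ∘ e) ∧ Set.range (y ∘ e) = Set.range y ∧
      ∀ w : ι → ℝ, ∑ k, w (e k) • (y ∘ e) k = ∑ k, w k • y k := by
  let e := (Fintype.equivFinOfCardEq hι).symm
  exact ⟨e, hy.comp_embedding e.toEmbedding, e.surjective.range_comp y,
    fun w => e.sum_comp fun k => w k • y k⟩

/-- Almost everywhere vanishing on a triangle forces a continuous function to vanish on its
interior. -/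
lemma eq_zero_on_open_triangle (hι : Fintype.card ι = 3) {y : ι → E3}
    (hy : AffineIndependent ℝ y) {F : Type*} [NormedAddCommGroup F] {C : Set E3}
    (hC : MeasurableSet C) (hsub : convexHull ℝ (Set.range y) ⊆ C) {g h : E3 → F}
    (hg : ∀ᵐ r ∂(μHE[2] : Measure E3).restrict C, g r = 0) (hh : Continuous h)
    (hgh : ∀ w : ι → ℝ, (∀ k, 0 < w k) → ∑ k, w k = 1 →
      g (∑ k, w k • y k) = h (∑ k, w k • y k)) :
    ∀ w : ι → ℝ, (∀ k, 0 < w k) → ∑ k, w k = 1 → h (∑ k, w k • y k) = 0 := by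
  obtain ⟨e, hye, hrange, hsum⟩ := exists_reindex_three hι hy
  intro w hw0 hw1
  by_contra hne
  let O : Set (ℝ × ℝ) := {p | 0 < p.1 ∧ 0 < p.2 ∧ 0 < 1 - p.1 - p.2}
  have hO : IsOpen O :=
    (isOpen_lt continuous_const continuous_fst).inter
      ((isOpen_lt continuous_const continuous_snd).inter
        (isOpen_lt continuous_const
          ((continuous_const.sub continuous_fst).sub continuous_snd)))
  obtain ⟨K, hK⟩ := (triangleMap_lipschitz hye).1
  -- If `h` were nonzero at one interior point, this open set of parameters would be nonempty and
  -- its image would have positive area; but `g = h` is nonzero on that image.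
  let U : Set (ℝ × ℝ) := O ∩ {p | h (triangleMap (y ∘ e) p) ≠ 0}
  have hU : IsOpen U := hO.inter (isOpen_ne_fun (hh.comp hK.continuous) continuous_const)
  have hw1' : w (e 0) + w (e 1) + w (e 2) = 1 := by
    rw [← Fin.sum_univ_three (fun k => w (e k)), e.sum_comp]; exact hw1
  have hpt : triangleMap (y ∘ e) (w (e 1), w (e 2)) = ∑ k, w k • y k := by
    rw [← hsum, triangleMap]
    refine Finset.sum_congr rfl fun k _ => ?_
    congr 1
    fin_cases k
    · simp; linarith
    · rfl
    · rfl
  have hUne : U.Nonempty := by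
    refine ⟨(w (e 1), w (e 2)), ⟨hw0 _, hw0 _, ?_⟩, ?_⟩
    · have := hw0 (e 0)
      change 0 < 1 - w (e 1) - w (e 2)
      linarith
    · change h (triangleMap _ _) ≠ 0
      rw [hpt]; exact hne
  refine measure_image_triangleMap_ne_zero hye hU hUne ?_
  rw [ae_iff, Measure.restrict_apply' hC] at hg
  refine measure_mono_null ?_ hg
  rintro _ ⟨⟨a, b⟩, ⟨⟨h1, h2, h3⟩, hne'⟩, rfl⟩
  let w' : ι → ℝ := fun k => (![1 - a - b, a, b] : Fin 3 → ℝ) (e.symm k)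
  have hw' : triangleMap (y ∘ e) (a, b) = ∑ k, w' k • y k := by
    rw [← hsum]
    simp [w', triangleMap]
  have hpos : ∀ k, 0 < w' k := by
    intro k
    simp only [w']
    generalize e.symm k = j
    fin_cases j
    · exact h3
    · exact h1
    · exact h2
  have hone : ∑ k, w' k = 1 := by
    rw [← e.sum_comp]
    simp [w', Fin.sum_univ_three]
    ring
  change h (triangleMap _ _) ≠ 0 at hne'
  rw [hw'] at hne' ⊢
  refine ⟨?_, hsub (mem_convexHull_range_iff.2 ⟨w', fun k => (hpos k).le, hone, rfl⟩)⟩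
  change ¬ g _ = 0
  rw [hgh w' hpos hone]
  exact hne'

lemma measure_convexHull_lt_top (hι : Fintype.card ι = 3) {y : ι → E3}
    (hy : AffineIndependent ℝ y) : (μHE[2] : Measure E3) (convexHull ℝ (Set.range y)) < ⊤ := by
  obtain ⟨e, hye, hrange, -⟩ := exists_reindex_three hι hy
  rw [← hrange]
  exact measure_convexHull_triangle_lt_top hye

lemma isCompact_convexHull_range (y : ι → E3) : IsCompact (convexHull ℝ (Set.range y)) :=
  (Set.finite_range y).isCompact_convexHull ℝ

/-- On a null triangle the constant function `1` would vanish almost everywhere, hence at the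
centroid. -/
lemma measure_convexHull_ne_zero (hι : Fintype.card ι = 3) {y : ι → E3}
    (hy : AffineIndependent ℝ y) : (μHE[2] : Measure E3) (convexHull ℝ (Set.range y)) ≠ 0 := by
  intro h0
  have h1 := eq_zero_on_open_triangle hι hy (F := ℝ) (isCompact_convexHull_range y).measurableSet
    subset_rfl (g := fun _ => 1) (h := fun _ => 1) (by
      rw [Measure.restrict_eq_zero.2 h0]; simp) continuous_const (fun _ _ _ => rfl)
    (fun _ => 1 / 3) (fun _ => by norm_num) (by simp [hι])
  exact one_ne_zero h1

lemma area_convexHull_ne_zero (hι : Fintype.card ι = 3) {y : ι → E3}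
    (hy : AffineIndependent ℝ y) : area (convexHull ℝ (Set.range y)) ≠ 0 :=
  ENNReal.toReal_ne_zero.2
    ⟨measure_convexHull_ne_zero hι hy, (measure_convexHull_lt_top hι hy).ne⟩

section Weights

variable (ι) in
/-- Positive barycentric weights on a triangle that give weight `1 / 2` to one corner. -/
noncomputable def halfWeight (i : ι) (k : ι) : ℝ := 1 / 4 + if k = i then 1 / 4 else 0

lemma halfWeight_pos (i k : ι) : 0 < halfWeight ι i k := by
  unfold halfWeight; split_ifs <;> norm_num

lemma sum_halfWeight (hι : Fintype.card ι = 3) (i : ι) : ∑ k, halfWeight ι i k = 1 := by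
  simp only [halfWeight, Finset.sum_add_distrib, Finset.sum_ite_eq', Finset.mem_univ, if_true]
  simp [hι]; norm_num

/-- Only interior points are available. The centroid gives `∑ v = 0`; the weights `1/2, 1/4, 1/4`
give `∑ v + v i = 0`. -/
lemma eq_zero_of_sum_mul_eq_zero (hι : Fintype.card ι = 3) {v : ι → ℝ}
    (h : ∀ w : ι → ℝ, (∀ k, 0 < w k) → ∑ k, w k = 1 → ∑ k, w k * v k = 0) : v = 0 := by
  ext i
  have h1 := h (fun _ => 1 / 3) (fun _ => by norm_num) (by simp [hι])
  have h2 := h (halfWeight ι i) (halfWeight_pos i) (sum_halfWeight hι i)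
  rw [← Finset.mul_sum] at h1
  simp only [halfWeight, add_mul, Finset.sum_add_distrib, ← Finset.mul_sum, ite_mul, zero_mul,
    Finset.sum_ite_eq', Finset.mem_univ, if_true] at h2
  simp only [Pi.zero_apply]
  linarith

/-- A Raviart-Thomas field that vanishes on a triangle has no fluxes. -/
lemma eq_zero_of_raviartThomas_eq_zero (hι : Fintype.card ι = 3) {y : ι → E3}
    (hy : AffineIndependent ℝ y) {φ : ι → ℝ}
    (h : ∀ w : ι → ℝ, (∀ k, 0 < w k) → ∑ k, w k = 1 →
      ∑ k, φ k • (∑ j, w j • y j - y k) = 0) : φ = 0 := by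
  -- With `S = ∑ φ`, the field is `∑ (S w k - φ k) • y k`. These coefficients sum to zero, so affine
  -- independence makes each of them vanish.
  have key : ∀ w : ι → ℝ, (∀ k, 0 < w k) → ∑ k, w k = 1 → ∀ i, (∑ k, φ k) * w i = φ i := by
    intro w hw0 hw1 i
    have h0 := h w hw0 hw1
    simp only [smul_sub, Finset.sum_sub_distrib, ← Finset.sum_smul] at h0
    have hs : ∑ k, ((∑ k, φ k) * w k - φ k) = 0 := by
      rw [Finset.sum_sub_distrib, ← Finset.mul_sum, hw1]; ring
    have := (affineIndependent_iff_of_fintype ℝ y).1 hy (fun k => (∑ k, φ k) * w k - φ k) hs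
    rw [Finset.weightedVSub_eq_linear_combination _ hs] at this
    refine sub_eq_zero.1 (this ?_ i)
    rw [← h0, Finset.smul_sum]
    simp only [sub_smul, Finset.sum_sub_distrib, mul_smul]
  ext i
  -- Two interior points with different `i`-th weight give `S / 3 = φ i = S / 2`, so both are zero.
  have h1 := key (fun _ => 1 / 3) (fun _ => by norm_num) (by simp [hι]) i
  have h2 := key (halfWeight ι i) (halfWeight_pos i) (sum_halfWeight hι i) i
  simp only [halfWeight, if_true] at h2
  simp only [Pi.zero_apply]
  linarith

end Weights

end Triangle

/-! ### Gram matrices -/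

section Tame

variable {F : Type*} [NormedAddCommGroup F]

/-- Bounded strongly measurable functions. -/
def IsTame (f : E3 → F) : Prop := StronglyMeasurable f ∧ ∃ C, ∀ r, ‖f r‖ ≤ C

lemma IsTame.sum {ι : Type*} {s : Finset ι} {f : ι → E3 → F} (hf : ∀ i ∈ s, IsTame (f i)) :
    IsTame fun r => ∑ i ∈ s, f i r := by
  refine ⟨Finset.stronglyMeasurable_fun_sum s fun i hi => (hf i hi).1, ?_⟩
  choose! C hC using fun i hi => (hf i hi).2
  exact ⟨∑ i ∈ s, C i, fun r => norm_sum_le_of_le s fun i hi => hC i hi r⟩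

lemma IsTame.indicator {T S : Set E3} (hT : MeasurableSet T) (hTS : T ⊆ S) (hS : IsCompact S)
    {f f' : E3 → F} (hf' : Continuous f') (h : ∀ r ∈ S, f r = f' r) :
    IsTame (T.indicator f) := by
  have he : T.indicator f = T.indicator f' := by
    ext1 r
    by_cases hr : r ∈ T
    · rw [Set.indicator_of_mem hr, Set.indicator_of_mem hr, h r (hTS hr)]
    · rw [Set.indicator_of_notMem hr, Set.indicator_of_notMem hr]
  rw [he]
  obtain ⟨C, hC⟩ := hS.exists_bound_of_continuousOn hf'.continuousOn
  refine ⟨hf'.stronglyMeasurable.indicator hT, max C 0, fun r => ?_⟩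
  by_cases hr : r ∈ T
  · rw [Set.indicator_of_mem hr]
    exact (hC r (hTS hr)).trans (le_max_left _ _)
  · rw [Set.indicator_of_notMem hr, norm_zero]
    exact le_max_right _ _

variable {ι : Type*} [Fintype ι]

/-- The piece chosen at `r` depends only on which pieces contain `r`. There are finitely many such
membership patterns `p`, and each occurs on a measurable set; `T j` collects the patterns whose
choice is `j`. -/
lemma exists_glue_eq_sum_indicator {S : ι → Set E3} (hS : ∀ i, MeasurableSet (S i)) :
    ∃ T : ι → Set E3, (∀ i, MeasurableSet (T i)) ∧ (∀ i, T i ⊆ S i) ∧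
      ∀ (f : ι → E3 → F) (r : E3), glue S f r = ∑ i, (T i).indicator (f i) r := by
  refine ⟨fun j => ⋃ p ∈ {p : ι → Prop | ∃ h : ∃ i, p i, h.choose = j},
    ⋂ i, {r | r ∈ S i ↔ p i}, fun j => ?_, fun j => ?_, fun f r => ?_⟩
  · refine MeasurableSet.biUnion (Set.to_countable _) fun p _ => MeasurableSet.iInter fun i => ?_
    by_cases hp : p i
    · simpa [hp] using hS i
    · have : {r | r ∈ S i ↔ p i} = (S i)ᶜ := by ext r; simp [hp]
      rw [this]
      exact (hS i).compl
  · intro r hr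
    simp only [Set.mem_iUnion, Set.mem_iInter] at hr
    obtain ⟨p, ⟨h, rfl⟩, hr⟩ := hr
    exact (hr _).2 h.choose_spec
  · have hmem : ∀ j, (r ∈ ⋃ p ∈ {p : ι → Prop | ∃ h : ∃ i, p i, h.choose = j},
        ⋂ i, {r | r ∈ S i ↔ p i}) ↔ ∃ h : ∃ i, r ∈ S i, h.choose = j := by
      intro j
      simp only [Set.mem_iUnion, Set.mem_iInter]
      constructor
      · rintro ⟨p, hp, hr⟩
        obtain rfl : (fun i => r ∈ S i) = p := funext fun i => propext (hr i)
        exact hp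
      · intro h
        exact ⟨fun i => r ∈ S i, h, fun i => Iff.rfl⟩
    simp only [Set.indicator_apply, hmem, glue]
    by_cases h : ∃ i, r ∈ S i
    · rw [dif_pos h, Finset.sum_eq_single h.choose]
      · rw [if_pos ⟨h, rfl⟩]
      · intro j _ hj
        rw [if_neg]
        rintro ⟨_, h'⟩
        exact hj h'.symm
      · simp
    · rw [dif_neg h]
      refine (Finset.sum_eq_zero fun j _ => ?_).symm
      rw [if_neg]
      rintro ⟨h', _⟩
      exact h h'

lemma IsTame.glue {S : ι → Set E3} (hS : ∀ i, IsCompact (S i)) {f f' : ι → E3 → F}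
    (hf' : ∀ i, Continuous (f' i)) (h : ∀ i, ∀ r ∈ S i, f i r = f' i r) :
    IsTame (glue S f) := by
  obtain ⟨T, hT, hTS, hglue⟩ :=
    exists_glue_eq_sum_indicator (F := F) (fun i => (hS i).measurableSet)
  rw [show LoopStar.glue S f = fun r => ∑ i, (T i).indicator (f i) r from funext (hglue f)]
  exact IsTame.sum fun i _ => IsTame.indicator (hT i) (hTS i) (hS i) (hf' i) (h i)

lemma glue_of_unique {S : ι → Set E3} (f : ι → E3 → F) {r : E3} {i : ι} (hi : r ∈ S i)
    (hu : ∀ j, r ∈ S j → j = i) : glue S f r = f i r := by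
  have h : ∃ i, r ∈ S i := ⟨i, hi⟩
  rw [glue, dif_pos h, hu _ h.choose_spec]

end Tame

namespace Surface

variable {Γ : Surface}

lemma card_subtype_cell (t : Γ.Cell) : Fintype.card {x // x ∈ (t : Finset E3)} = 3 := by
  rw [Fintype.card_coe]; exact t.2.2

lemma range_cell (t : Γ.Cell) :
    Set.range (fun x : {x // x ∈ (t : Finset E3)} => (x : E3)) = ((t : Finset E3) : Set E3) := by
  simp

lemma isCompact_cell (t : Γ.Cell) : IsCompact (convexHull ℝ ((t : Finset E3) : Set E3)) :=
  (t : Finset E3).finite_toSet.isCompact_convexHull ℝ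

lemma measure_cell_lt_top (t : Γ.Cell) :
    (μHE[2] : Measure E3) (convexHull ℝ ((t : Finset E3) : Set E3)) < ⊤ := by
  rw [← range_cell]
  exact measure_convexHull_lt_top (card_subtype_cell t) (Γ.K.indep t.2.1)

lemma area_cell_ne_zero (t : Γ.Cell) :
    area (convexHull ℝ ((t : Finset E3) : Set E3)) ≠ 0 := by
  rw [← range_cell]
  exact area_convexHull_ne_zero (card_subtype_cell t) (Γ.K.indep t.2.1)

lemma carrier_eq_iUnion : Γ.carrier = ⋃ t : Γ.Cell, convexHull ℝ ((t : Finset E3) : Set E3) := by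
  ext r; rw [mem_carrier_iff, Set.mem_iUnion]

lemma measurableSet_carrier : MeasurableSet Γ.carrier := by
  rw [carrier_eq_iUnion]
  exact MeasurableSet.iUnion fun t => (isCompact_cell t).measurableSet

instance : IsFiniteMeasure Γ.surfaceMeasure := by
  refine ⟨?_⟩
  rw [surfaceMeasure, Measure.restrict_apply_univ, carrier_eq_iUnion]
  exact (measure_iUnion_fintype_le _ _).trans_lt
    (ENNReal.sum_lt_top.2 fun t _ => measure_cell_lt_top t)

section Gram

variable {ι F : Type*} [Fintype ι] [NormedAddCommGroup F] [InnerProductSpace ℝ F]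

/-- The Gram matrix of an independent family is positive definite. -/
lemma posDef_gram {f : ι → E3 → F} (hf : ∀ i, IsTame (f i))
    (h : ∀ x : ι → ℝ, (∀ᵐ r ∂Γ.surfaceMeasure, ∑ i, x i • f i r = 0) → x = 0) :
    (Γ.gram f).PosDef := by
  have hint : ∀ {g g' : E3 → F}, IsTame g → IsTame g' →
      Integrable (fun r => inner ℝ (g r) (g' r)) Γ.surfaceMeasure := by
    rintro g g' ⟨hg, C, hC⟩ ⟨hg', C', hC'⟩
    refine Integrable.of_bound (hg.inner hg').aestronglyMeasurable (C * C')
      (Filter.Eventually.of_forall fun r => ?_)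
    exact (norm_inner_le_norm _ _).trans
      (mul_le_mul (hC r) (hC' r) (norm_nonneg _) ((norm_nonneg _).trans (hC r)))
  refine PosDef.of_dotProduct_mulVec_pos ?_ fun x hx => ?_
  · ext i j
    simp only [conjTranspose_apply, gram, of_apply, star_trivial]
    congr 1
    ext r
    exact real_inner_comm _ _
  · let g : E3 → F := fun r => ∑ i, x i • f i r
    have hx' : ∀ i, IsTame fun r => x i • f i r := fun i => by
      obtain ⟨h1, C, hC⟩ := hf i
      refine ⟨h1.const_smul (x i), ‖x i‖ * C, fun r => ?_⟩
      rw [norm_smul]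
      exact mul_le_mul_of_nonneg_left (hC r) (norm_nonneg _)
    have hg : IsTame g := IsTame.sum fun i _ => hx' i
    -- The quadratic form of the Gram matrix is the squared norm of the combination `g`; if it
    -- vanishes, so does `g` almost everywhere.
    have hq : star x ⬝ᵥ (Γ.gram f *ᵥ x) = ∫ r, inner ℝ (g r) (g r) ∂Γ.surfaceMeasure := by
      simp only [g, sum_inner, inner_sum]
      rw [integral_finsetSum _ fun j _ => integrable_finsetSum _ fun i _ => hint (hx' i) (hx' j)]
      simp only [dotProduct, mulVec, star_trivial, Finset.mul_sum]
      rw [Finset.sum_comm]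
      refine Finset.sum_congr rfl fun j _ => ?_
      rw [integral_finsetSum _ fun i _ => hint (hx' i) (hx' j)]
      refine Finset.sum_congr rfl fun i _ => ?_
      simp only [real_inner_smul_left, real_inner_smul_right, integral_const_mul, gram, of_apply]
      ring
    rw [hq]
    have hnn : 0 ≤ᵐ[Γ.surfaceMeasure] fun r => inner ℝ (g r) (g r) :=
      Filter.Eventually.of_forall fun r => real_inner_self_nonneg
    refine lt_of_le_of_ne (integral_nonneg_of_ae hnn) fun h0 => hx (h x ?_)
    filter_upwards [(integral_eq_zero_iff_of_nonneg_ae hnn (hint hg hg)).1 h0.symm] with r hr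
    exact inner_self_eq_zero.1 hr

end Gram

/-! ### Functions on the cells -/

section Cells

variable {F : Type*} [NormedAddCommGroup F]

lemma mem_cell_of_weights (t : Γ.Cell) {w : {x // x ∈ (t : Finset E3)} → ℝ}
    (hw : ∀ k, 0 < w k) (hw1 : ∑ k, w k = 1) :
    ∑ k, w k • (k : E3) ∈ convexHull ℝ ((t : Finset E3) : Set E3) := by
  rw [← range_cell]
  exact mem_convexHull_range_iff.2 ⟨w, fun k => (hw k).le, hw1, rfl⟩

/-- A point common to both cells is a combination of their common vertices. Its coordinates in `t`
are unique and all positive, so every vertex of `t` is a common one. -/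
lemma eq_of_mem_cell_of_pos {t t' : Γ.Cell} {c : E3 → ℝ} (hc : ∀ y ∈ (t : Finset E3), 0 < c y)
    (hc1 : ∑ y ∈ (t : Finset E3), c y = 1)
    (hr : ∑ y ∈ (t : Finset E3), c y • y ∈ convexHull ℝ ((t' : Finset E3) : Set E3)) :
    t' = t := by
  have hrt : ∑ y ∈ (t : Finset E3), c y • y ∈ convexHull ℝ ((t : Finset E3) : Set E3) :=
    (convex_convexHull ℝ _).sum_mem (fun y hy => (hc y hy).le) hc1
      fun y hy => subset_convexHull ℝ _ hy
  have h := Γ.K.inter_subset_convexHull t.2.1 t'.2.1 ⟨hrt, hr⟩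
  rw [← Finset.coe_inter, Finset.mem_convexHull'] at h
  obtain ⟨w, -, hw1, hw⟩ := h
  obtain ⟨A, -, hA⟩ := exists_continuous_coords_finset (Γ.K.indep t.2.1)
  let w' : E3 → ℝ := fun y => if y ∈ (t' : Finset E3) then w y else 0
  have h1 : ∑ y ∈ (t : Finset E3), w' y = 1 := by
    rw [← hw1, ← Finset.filter_mem_eq_inter, Finset.sum_filter]
  have h2 : ∑ y ∈ (t : Finset E3), w' y • y = ∑ y ∈ (t : Finset E3), c y • y := by
    rw [← hw, ← Finset.filter_mem_eq_inter, Finset.sum_filter]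
    exact Finset.sum_congr rfl fun y _ => by simp only [w', ite_smul, zero_smul]
  have hsub : (t : Finset E3) ⊆ t' := by
    intro y hy
    by_contra hy'
    have e1 := hA c hc1 y hy
    have e2 := hA w' h1 y hy
    rw [h2, e1] at e2
    have := hc y hy
    simp only [w', if_neg hy'] at e2
    linarith
  exact (Subtype.ext (Finset.eq_of_subset_of_card_le hsub (by rw [t.2.2, t'.2.2]))).symm

lemma eq_of_mem_cell {t t' : Γ.Cell} {w : {x // x ∈ (t : Finset E3)} → ℝ}
    (hw : ∀ k, 0 < w k) (hw1 : ∑ k, w k = 1)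
    (hr : ∑ k, w k • (k : E3) ∈ convexHull ℝ ((t' : Finset E3) : Set E3)) : t' = t := by
  let c : E3 → ℝ := fun y => if h : y ∈ (t : Finset E3) then w ⟨y, h⟩ else 0
  have hc : ∀ k : {x // x ∈ (t : Finset E3)}, c k = w k := fun k => by simp [c]
  refine eq_of_mem_cell_of_pos (c := c) (fun y hy => ?_) ?_ ?_
  · rw [hc ⟨y, hy⟩]; exact hw _
  · rw [← Finset.sum_coe_sort, ← hw1]
    exact Finset.sum_congr rfl fun k _ => hc k
  · rw [← Finset.sum_coe_sort]
    simpa only [hc] using hr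

lemma eq_zero_on_open_cell (t : Γ.Cell) {g h : E3 → F}
    (hg : ∀ᵐ r ∂Γ.surfaceMeasure, g r = 0) (hh : Continuous h)
    (hgh : ∀ w : {x // x ∈ (t : Finset E3)} → ℝ, (∀ k, 0 < w k) → ∑ k, w k = 1 →
      g (∑ k, w k • (k : E3)) = h (∑ k, w k • (k : E3))) :
    ∀ w : {x // x ∈ (t : Finset E3)} → ℝ, (∀ k, 0 < w k) → ∑ k, w k = 1 →
      h (∑ k, w k • (k : E3)) = 0 :=
  eq_zero_on_open_triangle (card_subtype_cell t) (Γ.K.indep t.2.1) measurableSet_carrier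
    (by
      have := convexHull_cell_subset t
      rw [← range_cell] at this
      exact this) hg hh hgh

lemma exists_interior_weights (t : Γ.Cell) : ∃ w : {x // x ∈ (t : Finset E3)} → ℝ,
    (∀ k, 0 < w k) ∧ ∑ k, w k = 1 :=
  ⟨fun _ => 1 / 3, fun _ => by norm_num, by simp [t.2.2]⟩

end Cells

/-! ### Gram matrices of patches and pyramids -/

lemma isTame_patch (n : Γ.Cell) : IsTame (Γ.patch n) := by
  have : Γ.patch n = (convexHull ℝ ((n : Finset E3) : Set E3)).indicator
      (fun _ => (area (convexHull ℝ ((n : Finset E3) : Set E3)))⁻¹) := by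
    ext r; simp [patch, Set.indicator_apply]
  rw [this]
  exact IsTame.indicator (isCompact_cell n).measurableSet subset_rfl (isCompact_cell n)
    continuous_const fun _ _ => rfl

/-- On the interior of a cell only its own patch is nonzero. -/
lemma posDef_gram_patch : (Γ.gram Γ.patch).PosDef := by
  refine posDef_gram isTame_patch fun x hx => ?_
  ext t
  obtain ⟨w, hw, hw1⟩ := exists_interior_weights t
  have := eq_zero_on_open_cell t hx
    (h := fun _ => x t * (area (convexHull ℝ ((t : Finset E3) : Set E3)))⁻¹) continuous_const
    (fun w hw hw1 => by
      rw [Finset.sum_eq_single t]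
      · rw [patch, if_pos (mem_cell_of_weights t hw hw1), smul_eq_mul]
      · intro t' _ ht'
        rw [patch, if_neg fun h => ht' (eq_of_mem_cell hw hw1 h), smul_zero]
      · simp) w hw hw1
  exact (mul_eq_zero.1 this).resolve_right (inv_ne_zero (area_cell_ne_zero t))

/-- The affine functions whose gluing is a pyramid. -/
lemma exists_pyramid_pieces (t : Γ.Cell) : ∃ A : E3 → {x // x ∈ (t : Finset E3)} → ℝ,
    Continuous A ∧ (∀ w : {x // x ∈ (t : Finset E3)} → ℝ, ∑ k, w k = 1 →
      A (∑ k, w k • (k : E3)) = w) ∧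
    ∀ r ∈ convexHull ℝ ((t : Finset E3) : Set E3),
      bary (fun x : {x // x ∈ (t : Finset E3)} => (x : E3)) r = A r := by
  obtain ⟨A, hA, hAw⟩ := exists_continuous_coords (Γ.K.indep t.2.1)
  refine ⟨A, hA, hAw, fun r hr => ?_⟩
  rw [← range_cell, mem_convexHull_range_iff] at hr
  obtain ⟨w, -, hw1, rfl⟩ := hr
  rw [bary_sum_smul (Γ.K.indep t.2.1) hw1]
  exact (hAw w hw1).symm

lemma isTame_pyramid (n : Γ.Vertex) : IsTame (Γ.pyramid n) := by
  choose A hA _ hAb using fun t : Γ.Cell => exists_pyramid_pieces t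
  refine IsTame.glue isCompact_cell
    (f' := fun t r => if h : (n : E3) ∈ (t : Finset E3) then A t r ⟨n, h⟩ else 0)
    (fun t => ?_) fun t r hr => ?_
  · by_cases h : (n : E3) ∈ (t : Finset E3)
    · simp only [h, dif_pos]
      exact (continuous_apply _).comp (hA t)
    · simp only [h, dif_neg, not_false_eq_true]
      exact continuous_const
  · rw [hAb t r hr]

/-- On a cell that contains `v` the combination is affine with the coefficients as nodal values. -/
lemma posDef_gram_pyramid : (Γ.gram Γ.pyramid).PosDef := by
  refine posDef_gram isTame_pyramid fun x hx => ?_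
  ext v
  obtain ⟨t, hvt⟩ := exists_cell_of_vertex v
  obtain ⟨A, hA, hAw, -⟩ := exists_pyramid_pieces t
  let vt : {x // x ∈ (t : Finset E3)} → Γ.Vertex := fun k => ⟨k, mem_vertices_of_mem_cell t k.2⟩
  have hvt_inj : Function.Injective vt := fun a b h =>
    Subtype.ext (congrArg (fun z : Γ.Vertex => (z : E3)) h)
  have key := eq_zero_on_open_cell t hx (h := fun r => ∑ k, A r k * x (vt k))
    (continuous_finsetSum _ fun k _ => ((continuous_apply k).comp hA).mul continuous_const)
    (fun w hw hw1 => by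
      rw [hAw w hw1]
      have hval : ∀ n, Γ.pyramid n (∑ k, w k • (k : E3)) =
          if h : (n : E3) ∈ (t : Finset E3) then w ⟨n, h⟩ else 0 := by
        intro n
        rw [pyramid, glue_of_unique (S := fun t : Γ.Cell => convexHull ℝ ((t : Finset E3) : Set E3))
          (i := t) _ (mem_cell_of_weights t hw hw1) fun t' h => eq_of_mem_cell hw hw1 h,
          bary_sum_smul (Γ.K.indep t.2.1) hw1]
      simp only [hval, smul_eq_mul]
      symm
      -- Pyramids of vertices outside `t` vanish at the interior point, which leaves the three
      -- corners.
      apply Finset.sum_of_injOn vt hvt_inj.injOn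
      · intro k _; simp
      · intro n _ hn
        rw [dif_neg, mul_zero]
        intro h
        exact hn ⟨⟨n, h⟩, by simp, rfl⟩
      · intro k _
        rw [dif_pos k.2, mul_comm])
  have h0 := eq_zero_of_sum_mul_eq_zero (card_subtype_cell t) (v := fun k => x (vt k))
    fun w hw hw1 => by
      have := key w hw hw1
      rwa [hAw w hw1] at this
  exact congrFun h0 ⟨v, hvt⟩

end Surface

/-! ### Gram matrix of the Rao-Wilton-Glisson functions -/

namespace Labels

variable {Γ : Surface} (R : Labels Γ)

lemma isTame_rwg (m : Γ.Edge) : IsTame (R.rwg m) := by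
  set S := convexHull ℝ ((R.cellPlus m : Finset E3) : Set E3) with hS
  set T := convexHull ℝ ((R.cellMinus m : Finset E3) : Set E3) with hT
  have hSc : IsCompact S := Surface.isCompact_cell _
  have hTc : IsCompact T := Surface.isCompact_cell _
  -- The definition gives precedence to `c⁺` on the common edge, hence the difference `T \ S` for
  -- the second piece.
  have h : R.rwg m = fun r => ∑ i : Fin 2,
      (![S.indicator fun r => (1 / (2 * area S)) • (r - R.rp m),
        (T \ S).indicator fun r => -((1 / (2 * area T)) • (r - R.rm m))] : Fin 2 → E3 → E3) i r := by
    ext1 r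
    simp only [Fin.sum_univ_two, Matrix.cons_val_zero, Matrix.cons_val_one, Set.indicator_apply,
      rwg, Set.mem_sdiff, ← hS, ← hT]
    by_cases h1 : r ∈ S <;> by_cases h2 : r ∈ T <;> simp [h1, h2]
  rw [h]
  refine IsTame.sum fun i _ => ?_
  fin_cases i
  · exact IsTame.indicator hSc.measurableSet subset_rfl hSc (by fun_prop) fun _ _ => rfl
  · exact IsTame.indicator (hTc.measurableSet.diff hSc.measurableSet) Set.sdiff_subset hTc
      (by fun_prop) fun _ _ => rfl

lemma eq_of_opposite {m m' : Γ.Edge} {t : Γ.Cell} {k : E3} (hkm : k ∉ (m : Finset E3))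
    (hkm' : k ∉ (m' : Finset E3)) (hm : (t : Finset E3) = insert k (m : Finset E3))
    (hm' : (t : Finset E3) = insert k (m' : Finset E3)) : m = m' := by
  apply Subtype.ext
  rw [← Finset.erase_insert hkm, ← hm, hm', Finset.erase_insert hkm']

lemma cellPlus_eq_insert (m : Γ.Edge) :
    R.rp m ∉ (m : Finset E3) ∧ (R.cellPlus m : Finset E3) = insert (R.rp m) (m : Finset E3) := by
  have h := Surface.pos_ne (R.pos_plus m)
  rw [R.edge_eq m]
  refine ⟨by simp [h.2.1.symm, h.2.2.symm], ?_⟩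
  ext y; simp [cellPlus]; tauto

lemma cellMinus_eq_insert (m : Γ.Edge) :
    R.rm m ∉ (m : Finset E3) ∧ (R.cellMinus m : Finset E3) = insert (R.rm m) (m : Finset E3) := by
  have h := Surface.pos_ne (R.pos_minus m)
  rw [R.edge_eq m]
  refine ⟨by simp [h.2.1.symm, h.2.2.symm], ?_⟩
  ext y; simp [cellMinus]; tauto

/-- The share of the edge `m` in the outward flux through the side of `t` opposite to `k`. -/
noncomputable def cellFlux (x : Γ.Edge → ℝ) (t : Γ.Cell) (k : E3) (m : Γ.Edge) : ℝ :=
  if t = R.cellPlus m ∧ k = R.rp m then x m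
  else if t = R.cellMinus m ∧ k = R.rm m then -x m else 0

lemma cellFlux_eq_zero {x : Γ.Edge → ℝ} {m m' : Γ.Edge} (hne : m' ≠ m) :
    R.cellFlux x (R.cellPlus m) (R.rp m) m' = 0 := by
  obtain ⟨h1, h2⟩ := R.cellPlus_eq_insert m
  rw [cellFlux, if_neg, if_neg]
  · rintro ⟨ht, hk⟩
    obtain ⟨h3, h4⟩ := R.cellMinus_eq_insert m'
    rw [← hk] at h3 h4
    exact hne (eq_of_opposite h3 h1 h4 (ht ▸ h2))
  · rintro ⟨ht, hk⟩
    obtain ⟨h3, h4⟩ := R.cellPlus_eq_insert m'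
    rw [← hk] at h3 h4
    exact hne (eq_of_opposite h3 h1 h4 (ht ▸ h2))

/-- On a cell the combination is a Raviart-Thomas field whose side fluxes are signed coefficients.
On `c⁺` of `m`, the side opposite to `r⁺` is `m` itself, so the flux through it is `x m` alone. -/
lemma posDef_gram_rwg : (Γ.gram R.rwg).PosDef := by
  refine Surface.posDef_gram R.isTame_rwg fun x hx => ?_
  ext m
  set t := R.cellPlus m with ht
  set a := area (convexHull ℝ ((t : Finset E3) : Set E3)) with ha
  have ha0 : a ≠ 0 := Surface.area_cell_ne_zero t
  let φ : {y // y ∈ (t : Finset E3)} → ℝ := fun k => ∑ m', R.cellFlux x t k m'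
  have hpm : ∀ m', R.rp m' ∈ (R.cellPlus m' : Finset E3) := fun m' => by simp [cellPlus]
  have hmm : ∀ m', R.rm m' ∈ (R.cellMinus m' : Finset E3) := fun m' => by simp [cellMinus]
  have key := Surface.eq_zero_on_open_cell t hx
    (h := fun r => (1 / (2 * a)) • ∑ k, φ k • (r - (k : E3)))
    (by fun_prop)
    (fun w hw hw1 => by
      set r := ∑ k, w k • (k : E3) with hr
      have hmem : ∀ t' : Γ.Cell, r ∈ convexHull ℝ ((t' : Finset E3) : Set E3) ↔ t = t' := by
        intro t'
        constructor
        · intro h; exact (Surface.eq_of_mem_cell hw hw1 h).symm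
        · rintro rfl; exact Surface.mem_cell_of_weights t hw hw1
      simp only [φ, Finset.sum_smul]
      rw [Finset.sum_comm, Finset.smul_sum]
      refine Finset.sum_congr rfl fun m' _ => ?_
      rw [rwg]
      simp only [hmem]
      by_cases h1 : t = R.cellPlus m'
      · rw [if_pos h1, Finset.sum_eq_single ⟨R.rp m', h1 ▸ hpm m'⟩]
        · rw [cellFlux, if_pos ⟨h1, rfl⟩, show area (convexHull ℝ
            ((R.cellPlus m' : Finset E3) : Set E3)) = a by rw [← h1], smul_comm]
        · intro k _ hk
          rw [cellFlux, if_neg fun h => hk (Subtype.ext h.2), if_neg, zero_smul]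
          rintro ⟨h2, -⟩
          exact R.cellPlus_ne_cellMinus m' (h1.symm.trans h2)
        · simp
      · rw [if_neg h1]
        by_cases h2 : t = R.cellMinus m'
        · rw [if_pos h2, Finset.sum_eq_single ⟨R.rm m', h2 ▸ hmm m'⟩]
          · rw [cellFlux, if_neg fun h => h1 h.1, if_pos ⟨h2, rfl⟩, show area (convexHull ℝ
              ((R.cellMinus m' : Finset E3) : Set E3)) = a by rw [← h2]]
            module
          · intro k _ hk
            rw [cellFlux, if_neg fun h => h1 h.1, if_neg fun h => hk (Subtype.ext h.2), zero_smul]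
          · simp
        · rw [if_neg h2, smul_zero, Finset.sum_eq_zero, smul_zero]
          intro k _
          rw [cellFlux, if_neg fun h => h1 h.1, if_neg fun h => h2 h.1, zero_smul])
  have h0 : φ = 0 := eq_zero_of_raviartThomas_eq_zero (Surface.card_subtype_cell t)
    (Γ.K.indep t.2.1) fun w hw hw1 => by
      have := key w hw hw1
      exact (smul_eq_zero.1 this).resolve_left (by simp [ha0])
  have h1 : φ ⟨R.rp m, hpm m⟩ = x m := by
    simp only [φ]
    rw [Finset.sum_eq_single m]
    · rw [cellFlux, if_pos ⟨rfl, rfl⟩]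
    · intro m' _ hm'
      exact R.cellFlux_eq_zero hm'
    · simp
  rw [← h1, h0]
  rfl

end Labels

namespace Surface

variable {Γ : Surface}

/-! ### Triangles of the barycentric refinement -/

lemma Flag.exists_vertices (F : Γ.Flag) : ∃ a b d : E3, (F.v : E3) = a ∧ a ≠ b ∧ a ≠ d ∧ b ≠ d ∧
    (F.e : Finset E3) = {a, b} ∧ (F.t : Finset E3) = {a, b, d} := by
  obtain ⟨x, y, hxy, he⟩ := Finset.card_eq_two.1 F.e.2.2
  obtain ⟨b, hvb, he⟩ : ∃ b, (F.v : E3) ≠ b ∧ (F.e : Finset E3) = {(F.v : E3), b} := by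
    have hv := F.v_mem
    rw [he] at hv
    simp only [Finset.mem_insert, Finset.mem_singleton] at hv
    rcases hv with hv | hv
    · exact ⟨y, hv ▸ hxy, hv ▸ he⟩
    · exact ⟨x, hv ▸ hxy.symm, by rw [he, hv, Finset.pair_comm]⟩
  obtain ⟨d, hd⟩ : ((F.t : Finset E3) \ F.e).Nonempty := by
    rw [← Finset.card_pos]
    have := Finset.le_card_sdiff (F.e : Finset E3) F.t
    rw [F.t.2.2, F.e.2.2] at this
    omega
  rw [he] at hd
  simp only [Finset.mem_sdiff, Finset.mem_insert, Finset.mem_singleton, not_or] at hd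
  have hs := F.e_sub
  rw [he] at hs
  exact ⟨F.v, b, d, rfl, hvb, Ne.symm hd.2.1, Ne.symm hd.2.2, he,
    (exists_pos_of_distinct F.t (hs (by simp)) (hs (by simp)) hd.1 hvb (Ne.symm hd.2.1)
      (Ne.symm hd.2.2)).1⟩

/-- Passage from coordinates in the refined triangle to coordinates in its cell: the midpoint
contributes halves to `a` and `b`, the centroid thirds to all vertices. For nonnegative weights the
coordinates decrease along `a, b, d`, so a flag encodes an ordering of the vertices of its cell. -/
lemma Flag.exists_coords (F : Γ.Flag) : ∃ a b d : E3, (F.v : E3) = a ∧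
    (F.e : Finset E3) = {a, b} ∧ (F.t : Finset E3) = {a, b, d} ∧
    ∀ w : Fin 3 → ℝ, ∃ c : E3 → ℝ, c a = w 0 + w 1 / 2 + w 2 / 3 ∧ c b = w 1 / 2 + w 2 / 3 ∧
      c d = w 2 / 3 ∧ ∑ y ∈ (F.t : Finset E3), c y = ∑ k, w k ∧
      ∑ y ∈ (F.t : Finset E3), c y • y = ∑ k, w k • F.corner k := by
  obtain ⟨a, b, d, hv, hab, had, hbd, he, ht⟩ := F.exists_vertices
  refine ⟨a, b, d, hv, he, ht, fun w => ⟨fun y => if y = a then w 0 + w 1 / 2 + w 2 / 3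
    else if y = b then w 1 / 2 + w 2 / 3 else w 2 / 3, ?_, ?_, ?_, ?_, ?_⟩⟩
  · simp
  · simp [hab.symm]
  · simp [had.symm, hbd.symm]
  · rw [ht, Finset.sum_insert (by simp [hab, had]), Finset.sum_pair hbd, Fin.sum_univ_three]
    simp only [if_true, if_neg hab.symm, if_neg had.symm, if_neg hbd.symm]
    ring
  · have h0 : F.corner 0 = a := hv
    have h1 : F.corner 1 = (1 / 2 : ℝ) • (a + b) := by
      change (1 / 2 : ℝ) • ∑ x ∈ (F.e : Finset E3), x = _
      rw [he, Finset.sum_pair hab]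
    have h2 : F.corner 2 = (1 / 3 : ℝ) • (a + (b + d)) := by
      change (1 / 3 : ℝ) • ∑ x ∈ (F.t : Finset E3), x = _
      rw [ht, Finset.sum_insert (by simp [hab, had]), Finset.sum_pair hbd]
    rw [ht, Finset.sum_insert (by simp [hab, had]), Finset.sum_pair hbd, Fin.sum_univ_three, h0, h1,
      h2]
    simp only [if_true, if_neg hab.symm, if_neg had.symm, if_neg hbd.symm]
    module

/-- The change of coordinates is triangular with nonzero diagonal, so independence is inherited from
the cell. -/
lemma Flag.affineIndependent_corner (F : Γ.Flag) : AffineIndependent ℝ F.corner := by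
  obtain ⟨a, b, d, -, -, ht, hF⟩ := F.exists_coords
  rw [affineIndependent_iff_of_fintype]
  intro w hw hw0
  rw [Finset.weightedVSub_eq_linear_combination _ hw] at hw0
  obtain ⟨c, ha, hb, hd, hc1, hc⟩ := hF w
  have hc0 : ∀ y ∈ (F.t : Finset E3), c y = 0 := by
    have hs : ∑ k : {x // x ∈ (F.t : Finset E3)}, c k = 0 := by
      rw [Finset.sum_coe_sort, hc1, hw]
    have := (affineIndependent_iff_of_fintype ℝ _).1 (Γ.K.indep F.t.2.1) (fun k => c k) hs
    rw [Finset.weightedVSub_eq_linear_combination _ hs] at this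
    intro y hy
    refine this ?_ ⟨y, hy⟩
    rw [← hw0, ← hc]
    exact Finset.sum_coe_sort (F.t : Finset E3) fun y => c y • y
  have ha' := hc0 a (by simp [ht])
  have hb' := hc0 b (by simp [ht])
  have hd' := hc0 d (by simp [ht])
  intro i
  fin_cases i
  · change w 0 = 0; linarith
  · change w 1 = 0; linarith
  · change w 2 = 0; linarith

lemma Flag.region_subset_cell (F : Γ.Flag) :
    F.region ⊆ convexHull ℝ ((F.t : Finset E3) : Set E3) := by
  intro r hr
  obtain ⟨w, hw, hw1, rfl⟩ := mem_convexHull_range_iff.1 hr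
  obtain ⟨a, b, d, -, -, ht, hF⟩ := F.exists_coords
  obtain ⟨c, ha, hb, hd, hc1, hc⟩ := hF w
  have h0 := hw 0
  have h1 := hw 1
  have h2 := hw 2
  rw [← hc]
  refine (convex_convexHull ℝ _).sum_mem (fun y hy => ?_) (hc1.trans hw1)
    fun y hy => subset_convexHull ℝ _ hy
  rw [ht] at hy
  simp only [Finset.mem_insert, Finset.mem_singleton] at hy
  rcases hy with rfl | rfl | rfl <;> linarith

lemma Flag.region_subset_carrier (F : Γ.Flag) : F.region ⊆ Γ.carrier :=
  F.region_subset_cell.trans (convexHull_cell_subset F.t)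

lemma Flag.isCompact_region (F : Γ.Flag) : IsCompact F.region := isCompact_convexHull_range _

lemma Flag.area_region_ne_zero (F : Γ.Flag) : area F.region ≠ 0 :=
  area_convexHull_ne_zero (by simp) F.affineIndependent_corner

lemma Flag.mem_region {F : Γ.Flag} {w : Fin 3 → ℝ} (hw : ∀ k, 0 < w k) (hw1 : ∑ k, w k = 1) :
    ∑ k, w k • F.corner k ∈ F.region :=
  mem_convexHull_range_iff.2 ⟨w, fun k => (hw k).le, hw1, rfl⟩

/-- The interiors of the triangles of the refinement meet no other triangle. -/
lemma Flag.eq_of_mem_region {F F' : Γ.Flag} {w : Fin 3 → ℝ} (hw : ∀ k, 0 < w k)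
    (hw1 : ∑ k, w k = 1) (hr : ∑ k, w k • F.corner k ∈ F'.region) : F' = F := by
  obtain ⟨a, b, d, hv, he, ht, hF⟩ := F.exists_coords
  obtain ⟨c, ha, hb, hd, hc1, hc⟩ := hF w
  have h0 := hw 0
  have h1 := hw 1
  have h2 := hw 2
  have htt : F'.t = F.t := by
    refine eq_of_mem_cell_of_pos (c := c) (fun y hy => ?_) (hc1.trans hw1) ?_
    · rw [ht] at hy
      simp only [Finset.mem_insert, Finset.mem_singleton] at hy
      rcases hy with rfl | rfl | rfl <;> linarith
    · rw [hc]; exact F'.region_subset_cell hr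
  obtain ⟨w', hw', hw1', hr'⟩ := mem_convexHull_range_iff.1 hr
  obtain ⟨a', b', d', hv', he', ht', hF'⟩ := F'.exists_coords
  obtain ⟨c', ha', hb', hd', hc1', hc'⟩ := hF' w'
  have h1' := hw' 1
  have h0' := hw' 0
  have h2' := hw' 2
  rw [htt] at hc1' hc' ht'
  obtain ⟨A, -, hA⟩ := exists_continuous_coords_finset (Γ.K.indep F.t.2.1)
  -- Both flags lie in the same cell, so the coordinates of the point in that cell coincide.
  have hcc : ∀ y ∈ (F.t : Finset E3), c y = c' y := by
    intro y hy
    rw [← hA c (hc1.trans hw1) y hy, ← hA c' (hc1'.trans hw1') y hy, hc, hc', hr']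
  have hma : a' ∈ (F.t : Finset E3) := by simp [ht']
  have hmb : b' ∈ (F.t : Finset E3) := by simp [ht']
  have hmd : d' ∈ (F.t : Finset E3) := by simp [ht']
  have ea := hcc a' hma
  have eb := hcc b' hmb
  have ed := hcc d' hmd
  have hset : ({a', b', d'} : Finset E3) = {a, b, d} := ht'.symm.trans ht
  have hma2 : a ∈ ({a', b', d'} : Finset E3) := by simp [hset]
  have hmb2 : b ∈ ({a', b', d'} : Finset E3) := by simp [hset]
  rw [ht] at hma hmb hmd
  simp only [Finset.mem_insert, Finset.mem_singleton] at hma hmb hmd hma2 hmb2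
  -- The coordinates decrease strictly along `a, b, d` and weakly along `a', b', d'`. The largest
  -- one identifies the vertex, the second largest then identifies the edge.
  have hmax : c a ≤ c a' := by
    rcases hma2 with h | h | h <;> rw [h] <;> linarith
  have haa : a' = a := by
    rcases hma with h | h | h
    · exact h
    · rw [h] at hmax; linarith
    · rw [h] at hmax; linarith
  subst haa
  have hab : a' ≠ b := by rintro rfl; linarith
  have hmax2 : c b ≤ c b' := by
    rcases hmb2 with h | h | h
    · exact absurd h.symm hab
    · rw [h]
    · rw [h]; linarith
  have hab' : a' ≠ b' := by
    intro h
    have := F'.e.2.2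
    rw [he', h] at this
    simp at this
  have hbb : b' = b := by
    rcases hmb with h | h | h
    · exact absurd h.symm hab'
    · exact h
    · rw [h] at hmax2; linarith
  subst hbb
  exact Flag.ext (Subtype.ext (hv'.trans hv.symm)) (Subtype.ext (he'.trans he.symm)) htt

lemma exists_flag_of_vertex (v : Γ.Vertex) : ∃ F : Γ.Flag, F.v = v := by
  obtain ⟨t, hv⟩ := exists_cell_of_vertex v
  obtain ⟨x, hx, hne⟩ : ∃ x ∈ (t : Finset E3), x ≠ v :=
    Finset.exists_mem_ne (by rw [t.2.2]; norm_num) _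
  have hsub : ({(v : E3), x} : Finset E3) ⊆ t := by
    intro y hy
    simp only [Finset.mem_insert, Finset.mem_singleton] at hy
    rcases hy with rfl | rfl <;> assumption
  exact ⟨⟨v, ⟨{(v : E3), x}, Γ.K.down_closed t.2.1 hsub (by simp), Finset.card_pair hne.symm⟩, t,
    by simp, hsub⟩, rfl⟩

lemma exists_flag_of_cell (t : Γ.Cell) : ∃ F : Γ.Flag, F.t = t := by
  obtain ⟨a, b, d, h, ht⟩ := exists_pos t
  have hsub : ({a, b} : Finset E3) ⊆ t := by
    rw [ht]; intro y; simp; tauto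
  exact ⟨⟨⟨a, mem_vertices_of_mem_cell t (by simp [ht])⟩, posEdge h, t, by simp [posEdge],
    hsub⟩, rfl⟩

lemma Flag.eq_zero_on_open_region (F : Γ.Flag) {E : Type*} [NormedAddCommGroup E] {g h : E3 → E}
    (hg : ∀ᵐ r ∂Γ.surfaceMeasure, g r = 0) (hh : Continuous h)
    (hgh : ∀ w : Fin 3 → ℝ, (∀ k, 0 < w k) → ∑ k, w k = 1 →
      g (∑ k, w k • F.corner k) = h (∑ k, w k • F.corner k)) :
    ∀ w : Fin 3 → ℝ, (∀ k, 0 < w k) → ∑ k, w k = 1 → h (∑ k, w k • F.corner k) = 0 :=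
  eq_zero_on_open_triangle (by simp) F.affineIndependent_corner measurableSet_carrier
    F.region_subset_carrier hg hh hgh

/-! ### Dual patches -/

lemma isCompact_dualCell (v : Γ.Vertex) : IsCompact (Γ.dualCell v) :=
  Set.Finite.isCompact_biUnion (Set.toFinite {F : Γ.Flag | F.v = v}) fun F _ => F.isCompact_region

lemma area_dualCell_ne_zero (v : Γ.Vertex) : area (Γ.dualCell v) ≠ 0 := by
  obtain ⟨F, hF⟩ := exists_flag_of_vertex v
  have hsub : F.region ⊆ Γ.dualCell v := Set.subset_iUnion₂_of_subset F hF subset_rfl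
  -- Finiteness has to be shown as well, since `area` sends infinite measure to zero.
  refine ENNReal.toReal_ne_zero.2 ⟨fun h0 => ?_, ?_⟩
  · exact measure_convexHull_ne_zero (by simp) F.affineIndependent_corner (measure_mono_null hsub h0)
  · refine ((measure_mono (t := ⋃ F : Γ.Flag, F.region) ?_).trans_lt ?_).ne
    · exact Set.iUnion₂_subset fun F _ => Set.subset_iUnion (fun F : Γ.Flag => F.region) F
    · exact (measure_iUnion_fintype_le _ _).trans_lt (ENNReal.sum_lt_top.2 fun F _ =>
        measure_convexHull_lt_top (by simp) F.affineIndependent_corner)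

lemma isTame_dualPatch (v : Γ.Vertex) : IsTame (Γ.dualPatch v) := by
  have : Γ.dualPatch v = (Γ.dualCell v).indicator fun _ => (area (Γ.dualCell v))⁻¹ := by
    ext r; simp [dualPatch, Set.indicator_apply]
  rw [this]
  exact IsTame.indicator (isCompact_dualCell v).measurableSet subset_rfl (isCompact_dualCell v)
    continuous_const fun _ _ => rfl

lemma posDef_gram_dualPatch : (Γ.gram Γ.dualPatch).PosDef := by
  refine posDef_gram isTame_dualPatch fun x hx => ?_
  ext v
  obtain ⟨F, rfl⟩ := exists_flag_of_vertex v
  have := F.eq_zero_on_open_region hx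
    (h := fun _ => x F.v * (area (Γ.dualCell F.v))⁻¹) continuous_const
    (fun w hw hw1 => by
      have hmem : ∀ v, ∑ k, w k • F.corner k ∈ Γ.dualCell v ↔ F.v = v := by
        intro v
        simp only [dualCell, Set.mem_iUnion]
        constructor
        · rintro ⟨F', hv, h⟩
          rw [← Flag.eq_of_mem_region hw hw1 h, hv]
        · intro h
          exact ⟨F, h, Flag.mem_region hw hw1⟩
      rw [Finset.sum_eq_single F.v]
      · rw [dualPatch, if_pos ((hmem _).2 rfl), smul_eq_mul]
      · intro v _ hv
        rw [dualPatch, if_neg fun h => hv ((hmem v).1 h).symm, smul_zero]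
      · simp) (fun _ => 1 / 3) (fun _ => by norm_num) (by simp)
  exact (mul_eq_zero.1 this).resolve_right (inv_ne_zero (area_dualCell_ne_zero _))

/-! ### Dual pyramids -/

/-- The nodal values of a dual pyramid on a triangle of the refinement. -/
noncomputable def dualPyramidValue (c : Γ.Cell) (F : Γ.Flag) : Fin 3 → ℝ :=
  ![if (F.v : E3) ∈ (c : Finset E3) then 1 / (Γ.valence F.v : ℝ) else 0,
    if (F.e : Finset E3) ⊆ (c : Finset E3) then 1 / 2 else 0,
    if F.t = c then 1 else 0]

lemma Flag.exists_continuous_bary (F : Γ.Flag) : ∃ A : E3 → Fin 3 → ℝ, Continuous A ∧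
    (∀ w : Fin 3 → ℝ, ∑ k, w k = 1 → A (∑ k, w k • F.corner k) = w) ∧
    ∀ r ∈ F.region, bary F.corner r = A r := by
  obtain ⟨A, hA, hAw⟩ := exists_continuous_coords F.affineIndependent_corner
  refine ⟨A, hA, hAw, fun r hr => ?_⟩
  obtain ⟨w, -, hw1, rfl⟩ := mem_convexHull_range_iff.1 hr
  rw [bary_sum_smul F.affineIndependent_corner hw1, hAw w hw1]

lemma isTame_dualPyramid (c : Γ.Cell) : IsTame (Γ.dualPyramid c) := by
  choose A hA _ hAb using fun F : Γ.Flag => F.exists_continuous_bary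
  refine IsTame.glue Flag.isCompact_region
    (f' := fun F r => ∑ k, A F r k * dualPyramidValue c F k) (fun F => ?_) fun F r hr => ?_
  · exact continuous_finsetSum _ fun k _ =>
      ((continuous_apply k).comp (hA F)).mul continuous_const
  · rw [hAb F r hr]; rfl

/-- On a refined triangle in the cell `c` the combination is affine, and at the centroid only the
dual pyramid of `c` is nonzero, with value `1`. The values at the other nodes play no role. -/
lemma posDef_gram_dualPyramid : (Γ.gram Γ.dualPyramid).PosDef := by
  refine posDef_gram isTame_dualPyramid fun x hx => ?_
  ext c
  obtain ⟨F, rfl⟩ := exists_flag_of_cell c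
  obtain ⟨A, hA, hAw, -⟩ := F.exists_continuous_bary
  have key := F.eq_zero_on_open_region hx
    (h := fun r => ∑ k, A r k * ∑ c, x c * dualPyramidValue c F k)
    (continuous_finsetSum _ fun k _ => ((continuous_apply k).comp hA).mul continuous_const)
    (fun w hw hw1 => by
      rw [hAw w hw1]
      have hval : ∀ c, Γ.dualPyramid c (∑ k, w k • F.corner k) =
          ∑ k, w k * dualPyramidValue c F k := by
        intro c
        rw [dualPyramid, glue_of_unique (S := fun F : Γ.Flag => F.region) (i := F) _
          (Flag.mem_region hw hw1) fun F' h => Flag.eq_of_mem_region hw hw1 h,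
          bary_sum_smul F.affineIndependent_corner hw1]
        rfl
      simp only [hval, smul_eq_mul, Finset.mul_sum]
      rw [Finset.sum_comm]
      exact Finset.sum_congr rfl fun k _ => Finset.sum_congr rfl fun c _ => by ring)
  have h0 := eq_zero_of_sum_mul_eq_zero (by simp)
    (v := fun k => ∑ c, x c * dualPyramidValue c F k) fun w hw hw1 => by
      have := key w hw hw1
      rwa [hAw w hw1] at this
  have h2 := congrFun h0 2
  have hv : ∀ c, dualPyramidValue c F 2 = if F.t = c then 1 else 0 := fun c => rfl
  simpa [hv] using h2

end Surface

/-! ### Dual vector elements -/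

namespace DualElements

variable {Γ : Surface} {R : Labels Γ} (D : DualElements R)

lemma isTame_fn (m : Γ.Edge) : IsTame (D.fn m) := by
  refine IsTame.glue Surface.Flag.isCompact_region (fun F => ?_) fun F r _ => rfl
  unfold Surface.Flag.field
  fun_prop

/-- Inside one refined triangle the combination is the Raviart-Thomas field of the combined fluxes.
-/
lemma sum_smul_flux_eq_zero {x : Γ.Edge → ℝ}
    (hx : ∀ᵐ r ∂Γ.surfaceMeasure, ∑ m, x m • D.fn m r = 0) (F : Γ.Flag) (k : Fin 3) :
    ∑ m, x m * D.flux m F k = 0 := by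
  have key := F.eq_zero_on_open_region hx
    (h := fun r => (1 / (2 * area F.region)) •
      ∑ k, (∑ m, x m * D.flux m F k) • (r - F.corner k)) (by fun_prop)
    (fun w hw hw1 => by
      have hval : ∀ m, D.fn m (∑ k, w k • F.corner k) =
          F.field (D.flux m F) (∑ k, w k • F.corner k) := fun m => by
        rw [fn, glue_of_unique (S := fun F : Γ.Flag => F.region) (i := F) _
          (Surface.Flag.mem_region hw hw1) fun F' h => Surface.Flag.eq_of_mem_region hw hw1 h]
      simp only [hval, Surface.Flag.field, Finset.smul_sum, Finset.sum_smul]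
      rw [Finset.sum_comm]
      refine Finset.sum_congr rfl fun k _ => Finset.sum_congr rfl fun m _ => ?_
      rw [smul_smul, smul_smul]
      congr 1
      ring)
  have h0 := eq_zero_of_raviartThomas_eq_zero (by simp) F.affineIndependent_corner
    (φ := fun k => ∑ m, x m * D.flux m F k) fun w hw hw1 =>
      (smul_eq_zero.1 (key w hw hw1)).resolve_left (by simp [F.area_region_ne_zero])
  exact congrFun h0 k

/-- Among all elements only the `m`-th has flux through the two segments of the dual edge of `m`,
and these two fluxes add up to one, so the coefficient of `m` is zero. -/
lemma posDef_gram_fn : (Γ.gram D.fn).PosDef := by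
  refine Surface.posDef_gram D.isTame_fn fun x hx => ?_
  ext m
  -- The two refined triangles at `v⁺` along `m`; their sides opposite to corner `0` are the two
  -- segments of the dual edge.
  let F : Γ.Flag := ⟨R.vertexPlus m, m, R.cellPlus m,
    by rw [R.edge_eq m]; simp [Labels.vertexPlus],
    by rw [R.edge_eq m]; intro y; simp [Labels.cellPlus]; tauto⟩
  let F' : Γ.Flag := ⟨R.vertexPlus m, m, R.cellMinus m,
    by rw [R.edge_eq m]; simp [Labels.vertexPlus],
    by rw [R.edge_eq m]; intro y; simp [Labels.cellMinus]; tauto⟩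
  have hne : F ≠ F' := fun h => R.cellPlus_ne_cellMinus m (congrArg Surface.Flag.t h)
  have h1 := D.sum_smul_flux_eq_zero hx F 0
  have h2 := D.sum_smul_flux_eq_zero hx F' 0
  have hz : ∀ m' ≠ m, D.flux m' F 0 = 0 ∧ D.flux m' F' 0 = 0 := fun m' hm' =>
    ⟨D.flux_other m' F hm'.symm, D.flux_other m' F' hm'.symm⟩
  rw [Finset.sum_eq_single m (fun m' _ hm' => by rw [(hz m' hm').1, mul_zero]) (by simp)] at h1
  rw [Finset.sum_eq_single m (fun m' _ hm' => by rw [(hz m' hm').2, mul_zero]) (by simp)] at h2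
  have h3 := D.flux_self m F F' hne rfl rfl rfl
  have h4 : R.loopMat m F.v = 1 := by
    simp [Labels.loopMat, F, Labels.vertexPlus]
  have h5 : x m * (D.flux m F 0 + D.flux m F' 0) = 0 := by rw [mul_add, h1, h2, add_zero]
  rw [h3, h4, mul_one] at h5
  exact h5

end DualElements

/-! ### Complementarity -/

section Main

variable {Γ : Surface} {R : Labels Γ}

/-- In the dual case Loop and Star exchange their normalizations; this is the transpose of the
primal orthogonality. -/
lemma normalizeUp_transpose_mul_normalizeDown {n p q : Type*} [Fintype n] [Fintype p] [Fintype q]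
    [DecidableEq n] [DecidableEq p] [DecidableEq q] {G : Matrix n n ℝ} (hG : G.PosDef)
    {H : Matrix p p ℝ} {K : Matrix q q ℝ} {A : Matrix n p ℝ} {B : Matrix n q ℝ}
    (hBA : Bᵀ * A = 0) : (normalizeUp G B K)ᵀ * normalizeDown G A H = 0 := by
  have hAB : Aᵀ * B = 0 := by rw [← transpose_transpose (Aᵀ * B), transpose_mul]; simp [hBA]
  have h := normalizeDown_transpose_mul_normalizeUp (H := K) (K := H) hG hAB
  rw [← transpose_transpose ((normalizeUp G B K)ᵀ * normalizeDown G A H), transpose_mul,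
    transpose_transpose, h, transpose_zero]

lemma submatrix_transpose_mul_submatrix {n p q p' q' : Type*} [Fintype n] {A : Matrix n p ℝ}
    {B : Matrix n q ℝ} (hBA : Bᵀ * A = 0) (κ : p' → p) (μ : q' → q) :
    (B.submatrix id μ)ᵀ * A.submatrix id κ = 0 := by
  ext i j
  exact congrFun (congrFun hBA (μ i)) (κ j)

lemma posDef_gram_comp {ι ι' F : Type*} [NormedAddCommGroup F] [InnerProductSpace ℝ F]
    {f : ι → E3 → F} (hf : (Γ.gram f).PosDef) {κ : ι' → ι} (hκ : Function.Injective κ) :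
    (Γ.gram fun i => f (κ i)).PosDef :=
  hf.submatrix hκ

variable {ι ι' : Type} [Fintype ι] [Fintype ι'] [DecidableEq ι] [DecidableEq ι']
  {κ : ι → Γ.Vertex} {μ : ι' → Γ.Cell}

lemma primalStar_transpose_mul_primalLoop (κ : ι → Γ.Vertex) (μ : ι' → Γ.Cell) :
    (R.primalStar μ)ᵀ * R.primalLoop κ = 0 :=
  normalizeDown_transpose_mul_normalizeUp R.posDef_gram_rwg
    (submatrix_transpose_mul_submatrix R.starMat_transpose_mul_loopMat κ μ)

lemma dualStar_transpose_mul_dualLoop (D : DualElements R) (κ : ι → Γ.Vertex) (μ : ι' → Γ.Cell) :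
    (D.dualStar μ)ᵀ * D.dualLoop κ = 0 :=
  normalizeUp_transpose_mul_normalizeDown D.posDef_gram_fn
    (submatrix_transpose_mul_submatrix R.starMat_transpose_mul_loopMat κ μ)

lemma rank_primalLoop (hκ : Function.Injective κ) :
    (R.primalLoop κ).rank = (R.loopMat.submatrix id κ).rank :=
  rank_normalizeUp R.posDef_gram_rwg (posDef_gram_comp Surface.posDef_gram_pyramid hκ) _

lemma rank_primalStar (hμ : Function.Injective μ) :
    (R.primalStar μ).rank = (R.starMat.submatrix id μ).rank :=
  rank_normalizeDown R.posDef_gram_rwg (posDef_gram_comp Surface.posDef_gram_patch hμ) _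

lemma rank_dualLoop (D : DualElements R) (hκ : Function.Injective κ) :
    (D.dualLoop κ).rank = (R.loopMat.submatrix id κ).rank :=
  rank_normalizeDown D.posDef_gram_fn (posDef_gram_comp Surface.posDef_gram_dualPatch hκ) _

lemma rank_dualStar (D : DualElements R) (hμ : Function.Injective μ) :
    (D.dualStar μ).rank = (R.starMat.submatrix id μ).rank :=
  rank_normalizeUp D.posDef_gram_fn (posDef_gram_comp Surface.posDef_gram_dualPyramid hμ) _

end Main

end LoopStar

/-! ### The complementarity theorem -/

theorem mainTheorem3 (Γ : LoopStar.Surface) (R : LoopStar.Labels Γ) (D : LoopStar.DualElements R)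
    (hΓ : SimplyConnectedSpace Γ.carrier) :
    -- complementarity of the primal and of the dual projectors
    LoopStar.proj (R.primalLoop id) + LoopStar.proj (R.primalStar id) = 1 ∧
    LoopStar.proj (D.dualLoop id) + LoopStar.proj (D.dualStar id) = 1 ∧
    -- orthogonality and ranks
    R.starMatᵀ * R.loopMat = 0 ∧
    R.loopMat.rank + R.starMat.rank = Fintype.card Γ.Edge ∧
    (R.primalLoop id).rank = R.loopMat.rank ∧ (R.primalStar id).rank = R.starMat.rank ∧
    (D.dualLoop id).rank = R.loopMat.rank ∧ (D.dualStar id).rank = R.starMat.rank ∧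
    -- every vector is the sum of a unique Loop part and a unique Star part,
    -- which the projectors retrieve
    (∀ x : Γ.Edge → ℝ,
      (∃ l s, x = R.primalLoop id *ᵥ l + R.primalStar id *ᵥ s) ∧
      ∀ l s, x = R.primalLoop id *ᵥ l + R.primalStar id *ᵥ s →
        R.primalLoop id *ᵥ l = LoopStar.proj (R.primalLoop id) *ᵥ x ∧
        R.primalStar id *ᵥ s = LoopStar.proj (R.primalStar id) *ᵥ x) ∧
    (∀ x : Γ.Edge → ℝ,
      (∃ l s, x = D.dualLoop id *ᵥ l + D.dualStar id *ᵥ s) ∧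
      ∀ l s, x = D.dualLoop id *ᵥ l + D.dualStar id *ᵥ s →
        D.dualLoop id *ᵥ l = LoopStar.proj (D.dualLoop id) *ᵥ x ∧
        D.dualStar id *ᵥ s = LoopStar.proj (D.dualStar id) *ᵥ x) ∧
    -- the same with one column removed from each matrix; the coefficients are then unique, too
    (∀ (v : Γ.Vertex) (c : Γ.Cell),
      LoopStar.proj (R.primalLoop (Γ.dropVertex v)) +
        LoopStar.proj (R.primalStar (Γ.dropCell c)) = 1 ∧
      LoopStar.proj (D.dualLoop (Γ.dropVertex v)) +
        LoopStar.proj (D.dualStar (Γ.dropCell c)) = 1 ∧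
      ∀ x : Γ.Edge → ℝ,
        (∃! p : ({n : Γ.Vertex // n ≠ v} → ℝ) × ({n : Γ.Cell // n ≠ c} → ℝ),
          x = R.primalLoop (Γ.dropVertex v) *ᵥ p.1 + R.primalStar (Γ.dropCell c) *ᵥ p.2) ∧
        (∃! p : ({n : Γ.Vertex // n ≠ v} → ℝ) × ({n : Γ.Cell // n ≠ c} → ℝ),
          x = D.dualLoop (Γ.dropVertex v) *ᵥ p.1 + D.dualStar (Γ.dropCell c) *ᵥ p.2)) := by
  have hsc : SimplyConnectedSpace Γ.carrier := hΓ
  have hpre : IsPreconnected Γ.carrier :=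
    isPreconnected_iff_preconnectedSpace.2 inferInstance
  have hrank := LoopStar.Labels.rank_loopMat_add_rank_starMat (R := R)
  have hL := LoopStar.rank_primalLoop (R := R) (κ := id) Function.injective_id
  have hS := LoopStar.rank_primalStar (R := R) (μ := id) Function.injective_id
  have hL' := LoopStar.rank_dualLoop D (κ := id) Function.injective_id
  have hS' := LoopStar.rank_dualStar D (μ := id) Function.injective_id
  rw [Matrix.submatrix_id_id] at hL hS hL' hS'
  have ho := LoopStar.primalStar_transpose_mul_primalLoop (R := R) id id
  have ho' := LoopStar.dualStar_transpose_mul_dualLoop D id id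
  have hr : (R.primalLoop id).rank + (R.primalStar id).rank = Fintype.card Γ.Edge := by
    rw [hL, hS, hrank]
  have hr' : (D.dualLoop id).rank + (D.dualStar id).rank = Fintype.card Γ.Edge := by
    rw [hL', hS', hrank]
  refine ⟨LoopStar.proj_add_proj ho hr, LoopStar.proj_add_proj ho' hr',
    R.starMat_transpose_mul_loopMat, hrank, hL, hS, hL', hS',
    fun x => ⟨LoopStar.exists_decomposition ho hr x,
      fun l s hx => LoopStar.proj_mulVec_of_eq ho hx⟩,
    fun x => ⟨LoopStar.exists_decomposition ho' hr' x,
      fun l s hx => LoopStar.proj_mulVec_of_eq ho' hx⟩,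
    fun v c => ?_⟩
  have hv : Function.Injective (Γ.dropVertex v) := Subtype.val_injective
  have hc : Function.Injective (Γ.dropCell c) := Subtype.val_injective
  -- Constants span the kernels on a connected surface, so after the removal the ranks are
  -- unchanged, which preserves complementarity, and equal the numbers of columns, which makes the
  -- coefficients unique.
  obtain ⟨hl1, hl2⟩ := LoopStar.rank_submatrix_dropColumn R.loopMat v R.loopMat_mulVec_one
    fun l hl => LoopStar.Labels.eq_of_loopMat_mulVec_eq_zero hpre hl
  obtain ⟨hs1, hs2⟩ := LoopStar.rank_submatrix_dropColumn R.starMat c R.starMat_mulVec_one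
    fun s hs => LoopStar.Labels.eq_of_starMat_mulVec_eq_zero hpre hs
  have kL := LoopStar.rank_primalLoop (R := R) hv
  have kS := LoopStar.rank_primalStar (R := R) hc
  have kL' := LoopStar.rank_dualLoop D hv
  have kS' := LoopStar.rank_dualStar D hc
  have ko := LoopStar.primalStar_transpose_mul_primalLoop (R := R) (Γ.dropVertex v) (Γ.dropCell c)
  have ko' := LoopStar.dualStar_transpose_mul_dualLoop D (Γ.dropVertex v) (Γ.dropCell c)
  have kr : (R.primalLoop (Γ.dropVertex v)).rank + (R.primalStar (Γ.dropCell c)).rank =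
      Fintype.card Γ.Edge := by
    rw [kL, kS, ← hrank, ← hl1, ← hs1]; rfl
  have kr' : (D.dualLoop (Γ.dropVertex v)).rank + (D.dualStar (Γ.dropCell c)).rank =
      Fintype.card Γ.Edge := by
    rw [kL', kS', ← hrank, ← hl1, ← hs1]; rfl
  exact ⟨LoopStar.proj_add_proj ko kr, LoopStar.proj_add_proj ko' kr', fun x =>
    ⟨LoopStar.existsUnique_decomposition ko kr (kL.trans hl2) (kS.trans hs2) x,
      LoopStar.existsUnique_decomposition ko' kr' (kL'.trans hl2) (kS'.trans hs2) x⟩⟩
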